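/- \textbf{Model.} There are $n\ge 1$ candidates; candidate $i\in[n]$ has a receiver utility $\rho_i\ge 0$ and a sender utility $\xi_i\ge 0$. All pairs $(\rho_i,\xi_i)$ are known in advance to both players. The candidates arrive in uniformly random order, one per round; $\theta_t$ is the candidate of round $t$. In round $t$ the sender sees $\theta_t$ and sends a signal $\sigma_t\in\{\mathrm{HIRE},\mathrm{NOT}\}$, according to a randomized mechanism to which she commits in advance and which may depend on $\theta_1,\dots,\theta_t$ and $\sigma_1,\dots,\sigma_{t-1}$. The receiver then irrevocably hires the current candidate (which ends the process) or rejects it. When deciding in round $t$ she knows $\sigma_1,\dots,\sigma_t$ and, in the scenario \emph{with disclosure}, also the rejected candidates $\theta_1,\dots,\theta_{t-1}$; she does not know $\theta_t$. If candidate $i$ is hired the players get $\rho_i$ and $\xi_i$; if nobody is hired both get $0$. A mechanism is \emph{persuasive} if in every round $t$ with $\sigma_1=\dots=\sigma_{t-1}=\mathrm{NOT}$, given all her information (including $\sigma_t$), the receiver maximizes her conditional expected utility over all strategies by obeying the signals from then on (hire upon the first $\mathrm{HIRE}$, never upon $\mathrm{NOT}$). Let $\mathrm{OPT}$ be the optimal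 (supremal) expected utility of the sender, with an obedient receiver, over all persuasive mechanisms in the scenario \emph{without} disclosure (the benchmark scenario). \textbf{Pareto procedure} on a nonempty set $C$ of candidates. Let $\mu=\frac1{|C|}\sum_{i\in C}\rho_i$, and let $c\in C$ maximize $\xi$ over $C$. If $\rho_c\ge\mu$, set $a=b=c$. Otherwise choose $a,b\in C$ with $\rho_a\le\mu\le\rho_b$ such that the segment from $(\rho_a,\xi_a)$ to $(\rho_b,\xi_b)$ lies on the Pareto frontier of $\mathrm{conv}\{(\rho_i,\xi_i): i\in C\}$, i.e. no point of the hull is strictly larger in both coordinates than a point of the segment. Let $\alpha=1$ if $\rho_a=\rho_b$; $\alpha=0$ if $\rho_a\neq\rho_b$ and $\xi_a=\xi_b$; and $\alpha=\frac{\mu-\rho_b}{\rho_a-\rho_b}$ otherwise. Return $a$ with probability $\alpha$ and $b$ with probability $1-\alpha$. Ties in the choice of $c,a,b$ are resolved by an arbitrary fixed rule. \textbf{Shrinking Pareto mechanism.} In round $t$, as long as no $\mathrm{HIRE}$ has been sent, run the Pareto procedure with fresh randomness on the set $R_t=[n]\setminus\{\theta_1,\dots,\theta_{t-1}\}$ of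 remaining candidates; signal $\mathrm{HIRE}$ if it returns $\theta_t$, and $\mathrm{NOT}$ otherwise. After a $\mathrm{HIRE}$ signal, signal $\mathrm{NOT}$ in all later rounds. \textbf{Theorem.} There is a sequence $\delta_n\to 0$ such that for every $n\ge 1$ and every instance $(\rho_i,\xi_i)_{i\in[n]}$ with nonnegative values, the Shrinking Pareto mechanism (with any tie-breaking rule) is persuasive in the scenario with disclosure, and with an obedient receiver it gives the sender expected utility at least $\left(\frac13-\delta_n\right)\mathrm{OPT}$. -/

import Mathlib

namespace OnlinePersuasion

/-! Candidates are the elements of `Fin n`; candidate `i` has receiver utility `ρ i` and sender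
utility `ξ i`. An arrival order is a permutation `θ` (candidate `θ t` arrives in round `t`), drawn
uniformly at random. A signal vector is `σ : Fin n → Bool`, with `true` for HIRE and `false` for
NOT. -/

/-- A randomized direct signaling mechanism (for a sender who knows all valuations):
`hireProb t θ σ` is the probability of the signal HIRE in round `t`, given the candidates that
arrived in rounds `≤ t` and the signals sent in rounds `< t`. -/
structure DirectMechanism (n : ℕ) where
  hireProb : Fin n → Equiv.Perm (Fin n) → (Fin n → Bool) → ℝ
  nonneg : ∀ t θ σ, 0 ≤ hireProb t θ σ
  le_one : ∀ t θ σ, hireProb t θ σ ≤ 1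
  causal : ∀ t θ θ' σ σ', (∀ s, s ≤ t → θ s = θ' s) → (∀ s, s < t → σ s = σ' s) →
    hireProb t θ σ = hireProb t θ' σ'

/-- Joint probability of the arrival order `θ` (uniform) and the signals `σ` that the mechanism
sends as long as the receiver keeps rejecting. -/
noncomputable def DirectMechanism.law {n : ℕ} (φ : DirectMechanism n)
    (θ : Equiv.Perm (Fin n)) (σ : Fin n → Bool) : ℝ :=
  1 / (n.factorial : ℝ) *
    ∏ t, (if σ t = true then φ.hireProb t θ σ else 1 - φ.hireProb t θ σ)

/-- The receiver has the same information when she decides in round `t`: she has seen the signals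
of rounds `≤ t` and, with disclosure, the candidates she rejected in rounds `< t`. -/
def SameInfo {n : ℕ} (disclosure : Bool) (t : Fin n) (θ θ' : Equiv.Perm (Fin n))
    (σ σ' : Fin n → Bool) : Prop :=
  (∀ s, s ≤ t → σ s = σ' s) ∧ (disclosure = true → ∀ s, s < t → θ s = θ' s)

/-- A strategy of the receiver: hire (`true`) or reject in round `t`, depending only on what she
knows in that round. -/
structure ReceiverStrategy (n : ℕ) (disclosure : Bool) where
  hires : Fin n → Equiv.Perm (Fin n) → (Fin n → Bool) → Bool
  adapted : ∀ t θ θ' σ σ', SameInfo disclosure t θ θ' σ σ' → hires t θ σ = hires t θ' σ'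

/-- Always follow the signal. -/
def obedient (n : ℕ) (disclosure : Bool) : ReceiverStrategy n disclosure where
  hires t _ σ := σ t
  adapted t _ _ _ _ h := h.1 t le_rfl

/-- The utility `u` of the candidate hired when the process has reached round `t₀` and the receiver
uses `d` from round `t₀` on: that of the first candidate hired, and `0` if nobody gets hired. -/
noncomputable def payoffFrom {n : ℕ} {disclosure : Bool} (u : Fin n → ℝ)
    (d : ReceiverStrategy n disclosure) (t₀ : Fin n) (θ : Equiv.Perm (Fin n))
    (σ : Fin n → Bool) : ℝ :=
  open Classical in
  ∑ t, if t₀ ≤ t ∧ d.hires t θ σ = true ∧ (∀ s, t₀ ≤ s → s < t → d.hires s θ σ = false)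
    then u (θ t) else 0

/-- Expected utility of the receiver from using `d` from round `t` on, restricted to the event that
her information in round `t` is the one given by `(θ₀, σ₀)`. This is the conditional expected
utility times the probability of that event. -/
noncomputable def utilityAt {n : ℕ} {disclosure : Bool} (ρ : Fin n → ℝ) (φ : DirectMechanism n)
    (d : ReceiverStrategy n disclosure) (t : Fin n) (θ₀ : Equiv.Perm (Fin n))
    (σ₀ : Fin n → Bool) : ℝ :=
  open Classical in
  ∑ θ, ∑ σ, if SameInfo disclosure t θ₀ θ σ₀ σ then φ.law θ σ * payoffFrom ρ d t θ σ else 0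

/-- In every round `t` that an obedient receiver can reach (all earlier signals were NOT), whatever
her information including the current signal, obedience maximizes her conditional expected utility
over all strategies. -/
def Persuasive {n : ℕ} (disclosure : Bool) (ρ : Fin n → ℝ) (φ : DirectMechanism n) : Prop :=
  ∀ (t : Fin n) (θ₀ : Equiv.Perm (Fin n)) (σ₀ : Fin n → Bool), (∀ s, s < t → σ₀ s = false) →
    ∀ d : ReceiverStrategy n disclosure,
      utilityAt ρ φ d t θ₀ σ₀ ≤ utilityAt ρ φ (obedient n disclosure) t θ₀ σ₀

/-- Utility `u` of the candidate hired by an obedient receiver: the first one with signal HIRE. -/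
noncomputable def obedientPayoff {n : ℕ} (u : Fin n → ℝ) (θ : Equiv.Perm (Fin n))
    (σ : Fin n → Bool) : ℝ :=
  open Classical in
  ∑ t, if σ t = true ∧ (∀ s, s < t → σ s = false) then u (θ t) else 0

/-- Expected utility of the sender when the receiver is obedient. -/
noncomputable def senderUtility {n : ℕ} (ξ : Fin n → ℝ) (φ : DirectMechanism n) : ℝ :=
  ∑ θ, ∑ σ, φ.law θ σ * obedientPayoff ξ θ σ

/-- The values that persuasive mechanisms give to the sender in the benchmark scenario, where
rejected candidates are not disclosed. -/
def benchmarkValues {n : ℕ} (ρ ξ : Fin n → ℝ) : Set ℝ :=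
  {v | ∃ φ : DirectMechanism n, Persuasive false ρ φ ∧ senderUtility ξ φ = v}

/-- The optimum of the benchmark scenario. -/
noncomputable def benchmarkOpt {n : ℕ} (ρ ξ : Fin n → ℝ) : ℝ := sSup (benchmarkValues ρ ξ)

/-! ### The Pareto procedure -/

/-- The average receiver utility of the candidates in `C`. -/
noncomputable def receiverMean {n : ℕ} (ρ : Fin n → ℝ) (C : Finset (Fin n)) : ℝ :=
  (∑ i ∈ C, ρ i) / (C.card : ℝ)

/-- The convex hull of the valuation pairs of the candidates in `C`. -/
def valuationHull {n : ℕ} (ρ ξ : Fin n → ℝ) (C : Finset (Fin n)) : Set (ℝ × ℝ) :=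
  convexHull ℝ ((fun i => (ρ i, ξ i)) '' (C : Set (Fin n)))

/-- The Pareto frontier (upper right boundary) of the convex hull: the points for which no point of
the hull is better for both players. -/
def paretoFrontier {n : ℕ} (ρ ξ : Fin n → ℝ) (C : Finset (Fin n)) : Set (ℝ × ℝ) :=
  {p | p ∈ valuationHull ρ ξ C ∧ ∀ q ∈ valuationHull ρ ξ C, ¬ (p.1 < q.1 ∧ p.2 < q.2)}

/-- `a, b` is a possible choice of the Pareto procedure on `C`: with `c` a sender-optimal candidate,
`a = b = c` if `c` gives the receiver at least the mean, and otherwise `a` and `b` are the ends of a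
segment of the Pareto frontier that meets the vertical line at the mean. -/
def IsParetoPair {n : ℕ} (ρ ξ : Fin n → ℝ) (C : Finset (Fin n)) (a b : Fin n) : Prop :=
  ∃ c ∈ C, (∀ i ∈ C, ξ i ≤ ξ c) ∧
    ((receiverMean ρ C ≤ ρ c ∧ a = c ∧ b = c) ∨
      (ρ c < receiverMean ρ C ∧ a ∈ C ∧ b ∈ C ∧
        ρ a ≤ receiverMean ρ C ∧ receiverMean ρ C ≤ ρ b ∧
        segment ℝ (ρ a, ξ a) (ρ b, ξ b) ⊆ paretoFrontier ρ ξ C))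

/-- The Pareto procedure, with some way to resolve ties: for every nonempty set of candidates it
fixes a pair `a, b`. -/
structure ParetoProcedure {n : ℕ} (ρ ξ : Fin n → ℝ) where
  a : Finset (Fin n) → Fin n
  b : Finset (Fin n) → Fin n
  isParetoPair : ∀ C : Finset (Fin n), C.Nonempty → IsParetoPair ρ ξ C (a C) (b C)

/-- Probability with which the procedure returns `a` instead of `b`. -/
noncomputable def ParetoProcedure.alpha {n : ℕ} {ρ ξ : Fin n → ℝ} (P : ParetoProcedure ρ ξ)
    (C : Finset (Fin n)) : ℝ :=
  open Classical in
  if ρ (P.a C) = ρ (P.b C) then 1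
  else if ξ (P.a C) = ξ (P.b C) then 0
  else (receiverMean ρ C - ρ (P.b C)) / (ρ (P.a C) - ρ (P.b C))

/-- Probability that the candidate returned by the procedure on input `C` is `i`. -/
noncomputable def ParetoProcedure.returnProb {n : ℕ} {ρ ξ : Fin n → ℝ} (P : ParetoProcedure ρ ξ)
    (C : Finset (Fin n)) (i : Fin n) : ℝ :=
  (if i = P.a C then P.alpha C else 0) + (if i = P.b C then 1 - P.alpha C else 0)

theorem ParetoProcedure.alpha_mem {n : ℕ} {ρ ξ : Fin n → ℝ} (P : ParetoProcedure ρ ξ)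
    (C : Finset (Fin n)) (hC : C.Nonempty) : 0 ≤ P.alpha C ∧ P.alpha C ≤ 1 := by
  unfold ParetoProcedure.alpha
  split_ifs with h1 h2
  · simp
  · simp
  · obtain ⟨c, -, -, ⟨-, ha, hb⟩ | ⟨-, -, -, h3, h4, -⟩⟩ := P.isParetoPair C hC
    · exact absurd (by rw [ha, hb]) h1
    · have h5 : ρ (P.a C) - ρ (P.b C) < 0 :=
        sub_neg.2 (lt_of_le_of_ne (h3.trans h4) h1)
      constructor
      · exact div_nonneg_of_nonpos (by linarith) h5.le
      · rw [div_le_one_of_neg h5]; linarith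

theorem ParetoProcedure.returnProb_mem {n : ℕ} {ρ ξ : Fin n → ℝ} (P : ParetoProcedure ρ ξ)
    (C : Finset (Fin n)) (hC : C.Nonempty) (i : Fin n) :
    0 ≤ P.returnProb C i ∧ P.returnProb C i ≤ 1 := by
  obtain ⟨h1, h2⟩ := P.alpha_mem C hC
  unfold ParetoProcedure.returnProb
  split_ifs <;> constructor <;> linarith

/-- The candidates that have not arrived before round `t`. -/
def remaining {n : ℕ} (t : Fin n) (θ : Equiv.Perm (Fin n)) : Finset (Fin n) :=
  Finset.univ.filter (fun i => ∀ s, s < t → θ s ≠ i)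

theorem mem_remaining {n : ℕ} (t : Fin n) (θ : Equiv.Perm (Fin n)) : θ t ∈ remaining t θ := by
  simp only [remaining, Finset.mem_filter, Finset.mem_univ, true_and]
  intro s hs h
  exact hs.ne (θ.injective h)

/-- The Shrinking Pareto mechanism: as long as no HIRE has been signaled, run the Pareto procedure
with fresh randomness on the set of remaining candidates, and signal HIRE exactly if it returns the
candidate that arrives in the current round. After a HIRE, signal NOT forever. -/
noncomputable def ParetoProcedure.shrinkingPareto {n : ℕ} {ρ ξ : Fin n → ℝ}
    (P : ParetoProcedure ρ ξ) : DirectMechanism n where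
  hireProb t θ σ :=
    open Classical in
    if ∃ s, s < t ∧ σ s = true then 0 else P.returnProb (remaining t θ) (θ t)
  nonneg t θ σ := by
    split_ifs
    · exact le_rfl
    · exact (P.returnProb_mem _ ⟨_, mem_remaining t θ⟩ _).1
  le_one t θ σ := by
    split_ifs
    · exact zero_le_one
    · exact (P.returnProb_mem _ ⟨_, mem_remaining t θ⟩ _).2
  causal t θ θ' σ σ' hθ hσ := by
    have h1 : (∃ s, s < t ∧ σ s = true) ↔ (∃ s, s < t ∧ σ' s = true) := by
      constructor <;> rintro ⟨s, hs, h⟩ <;> refine ⟨s, hs, ?_⟩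
      · rw [← hσ s hs]; exact h
      · rw [hσ s hs]; exact h
    have h2 : remaining t θ = remaining t θ' := by
      ext i
      simp only [remaining, Finset.mem_filter, Finset.mem_univ, true_and]
      refine forall_congr' fun s => forall_congr' fun hs => ?_
      rw [hθ s hs.le]
    simp only [h1, h2, hθ t le_rfl]

/-! ### The notions are well defined -/

/-- A non-increasing line above all valuation pairs carries a part of the Pareto frontier. -/
theorem segment_subset_paretoFrontier {n : ℕ} {ρ ξ : Fin n → ℝ} {C : Finset (Fin n)} {a b : Fin n}
    (ha : a ∈ C) (hb : b ∈ C) (m k : ℝ) (hm : m ≤ 0) (hC : ∀ i ∈ C, ξ i - m * ρ i ≤ k)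
    (hka : ξ a - m * ρ a = k) (hkb : ξ b - m * ρ b = k) :
    segment ℝ (ρ a, ξ a) (ρ b, ξ b) ⊆ paretoFrontier ρ ξ C := by
  have hull : ∀ q ∈ valuationHull ρ ξ C, q.2 - m * q.1 ≤ k := by
    have hconv : Convex ℝ {q : ℝ × ℝ | q.2 - m * q.1 ≤ k} := by
      intro x hx y hy s t hs ht hst
      simp only [Set.mem_ofPred_eq, Prod.snd_add, Prod.smul_snd, Prod.fst_add, Prod.smul_fst,
        smul_eq_mul] at hx hy ⊢
      obtain rfl : t = 1 - s := by linarith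
      nlinarith
    intro q hq
    refine convexHull_min ?_ hconv hq
    rintro _ ⟨i, hi, rfl⟩
    exact hC i (by simpa using hi)
  intro p hp
  have mem : ∀ i ∈ C, (ρ i, ξ i) ∈ (fun i => (ρ i, ξ i)) '' (C : Set (Fin n)) :=
    fun i hi => ⟨i, by simpa using hi, rfl⟩
  refine ⟨segment_subset_convexHull (mem a ha) (mem b hb) hp, ?_⟩
  rintro q hq ⟨h1, h2⟩
  have h3 := hull q hq
  obtain ⟨s, t, hs, ht, hst, rfl⟩ := hp
  simp only [Prod.snd_add, Prod.smul_snd, Prod.fst_add, Prod.smul_fst, smul_eq_mul] at h1 h2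
  obtain rfl : t = 1 - s := by linarith
  have h4 : (s * ξ a + (1 - s) * ξ b) - m * (s * ρ a + (1 - s) * ρ b) = k := by
    linear_combination s * hka + (1 - s) * hkb
  nlinarith

theorem exists_isParetoPair {n : ℕ} (ρ ξ : Fin n → ℝ) (C : Finset (Fin n)) (hC : C.Nonempty) :
    ∃ a b, IsParetoPair ρ ξ C a b := by
  classical
  obtain ⟨c, hc, hmax⟩ := C.exists_max_image ξ hC
  set μ := receiverMean ρ C with hμ
  rcases le_or_gt μ (ρ c) with h | h
  · exact ⟨c, c, c, hc, hmax, Or.inl ⟨h, rfl, rfl⟩⟩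
  have hcard : (0 : ℝ) < C.card := by exact_mod_cast hC.card_pos
  have hright : ∃ j ∈ C, μ ≤ ρ j := by
    by_contra! hcon
    have : ∑ i ∈ C, ρ i < ∑ _i ∈ C, μ := Finset.sum_lt_sum_of_nonempty hC hcon
    rw [Finset.sum_const, nsmul_eq_mul, hμ, receiverMean, mul_div_cancel₀ _ hcard.ne'] at this
    exact lt_irrefl _ this
  obtain ⟨j₀, hj₀, hj₀μ⟩ := hright
  let L := C.filter fun i => ρ i < μ
  let R := C.filter fun i => μ ≤ ρ i
  have hcL : c ∈ L := by simp [L, hc, h]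
  have hjR : j₀ ∈ R := by simp [R, hj₀, hj₀μ]
  -- the height over `μ` of the chord from `i` to `j`
  let v : Fin n × Fin n → ℝ := fun p =>
    ξ p.1 + (ξ p.2 - ξ p.1) * ((μ - ρ p.1) / (ρ p.2 - ρ p.1))
  obtain ⟨⟨a₀, b⟩, hab, hv⟩ := (L ×ˢ R).exists_max_image v ⟨(c, j₀), by simp [hcL, hjR]⟩
  set V := v (a₀, b) with hV
  obtain ⟨a, haL, ha⟩ := L.exists_min_image (fun i => (V - ξ i) / (μ - ρ i)) ⟨c, hcL⟩
  set m := (V - ξ a) / (μ - ρ a) with hm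
  simp only [Finset.mem_product] at hab
  have memL : ∀ {i}, i ∈ L ↔ i ∈ C ∧ ρ i < μ := by simp [L]
  have memR : ∀ {i}, i ∈ R ↔ i ∈ C ∧ μ ≤ ρ i := by simp [R]
  have key : ∀ i j, ρ i < μ → μ ≤ ρ j →
      v (i, j) * (ρ j - ρ i) = ξ i * (ρ j - μ) + ξ j * (μ - ρ i) := by
    intro i j hi hj
    have : ρ j - ρ i ≠ 0 := by linarith
    simp only [v]
    field_simp
    ring
  obtain ⟨haC, haμ⟩ := memL.1 haL
  obtain ⟨ha₀C, ha₀μ⟩ := memL.1 hab.1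
  obtain ⟨hbC, hbμ⟩ := memR.1 hab.2
  have hma : m * (μ - ρ a) = V - ξ a := div_mul_cancel₀ _ (by linarith)
  have hle : ∀ i, i ∈ L → m * (μ - ρ i) ≤ V - ξ i := fun i hi =>
    (le_div_iff₀ (by linarith [(memL.1 hi).2])).1 (ha i hi)
  have hVij : ∀ i j, i ∈ L → j ∈ R → ξ i * (ρ j - μ) + ξ j * (μ - ρ i) ≤ V * (ρ j - ρ i) := by
    intro i j hi hj
    rw [← key i j (memL.1 hi).2 (memR.1 hj).2]
    exact mul_le_mul_of_nonneg_right (hv (i, j) (by simp [hi, hj]))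
      (by linarith [(memL.1 hi).2, (memR.1 hj).2])
  have hVab := key a₀ b ha₀μ hbμ
  have hVc : V ≤ ξ c := by
    have h1 := hmax a₀ ha₀C
    have h2 := hmax b hbC
    nlinarith
  have hm0 : m ≤ 0 := by
    have := hle c hcL
    nlinarith
  -- every valuation pair lies below the line of slope `m` through `(μ, V)`
  have hbelow : ∀ i ∈ C, ξ i - m * ρ i ≤ V - m * μ := by
    intro i hi
    rcases lt_or_ge (ρ i) μ with hiμ | hiμ
    · have := hle i (memL.2 ⟨hi, hiμ⟩)
      linarith
    · have := hVij a i haL (memR.2 ⟨hi, hiμ⟩)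
      have h3 : 0 < μ - ρ a := by linarith
      by_contra! hcon
      nlinarith
  have hbeq : ξ b - m * ρ b = V - m * μ := by
    refine le_antisymm (hbelow b hbC) ?_
    have := hle a₀ hab.1
    have h3 : 0 < μ - ρ a₀ := by linarith
    by_contra! hcon
    nlinarith
  refine ⟨a, b, c, hc, hmax, Or.inr ⟨h, haC, hbC, haμ.le, hbμ, ?_⟩⟩
  exact segment_subset_paretoFrontier haC hbC m (V - m * μ) hm0 hbelow (by linarith) hbeq

/-- The Pareto procedure exists. -/
theorem nonempty_paretoProcedure {n : ℕ} (hn : 0 < n) (ρ ξ : Fin n → ℝ) :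
    Nonempty (ParetoProcedure ρ ξ) := by
  classical
  choose a b hab using exists_isParetoPair ρ ξ
  exact ⟨⟨fun C => if h : C.Nonempty then a C h else ⟨0, hn⟩,
    fun C => if h : C.Nonempty then b C h else ⟨0, hn⟩, fun C h => by simpa [h] using hab C h⟩⟩

/-- Always signal HIRE. -/
def alwaysHire (n : ℕ) : DirectMechanism n where
  hireProb _ _ _ := 1
  nonneg _ _ _ := zero_le_one
  le_one _ _ _ := le_rfl
  causal _ _ _ _ _ _ _ := rfl

theorem law_alwaysHire {n : ℕ} (θ : Equiv.Perm (Fin n)) (σ : Fin n → Bool) :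
    (alwaysHire n).law θ σ = if σ = (fun _ => true) then 1 / (n.factorial : ℝ) else 0 := by
  unfold DirectMechanism.law
  split_ifs with h
  · subst h; simp [alwaysHire]
  · obtain ⟨t, ht⟩ : ∃ t, σ t ≠ true := by
      by_contra! hcon; exact h (funext hcon)
    rw [Finset.prod_eq_zero (Finset.mem_univ t), mul_zero]
    simp [ht, alwaysHire]

theorem persuasive_alwaysHire {n : ℕ} (ρ : Fin n → ℝ) (hρ : ∀ i, 0 ≤ ρ i) :
    Persuasive false ρ (alwaysHire n) := by
  classical
  intro t θ₀ σ₀ _ d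
  have key : ∑ θ, payoffFrom ρ d t θ (fun _ => true) ≤
      ∑ θ, payoffFrom ρ (obedient n false) t θ (fun _ => true) := by
    have hob : ∀ θ, payoffFrom ρ (obedient n false) t θ (fun _ => true) = ρ (θ t) := by
      intro θ
      unfold payoffFrom
      rw [Finset.sum_eq_single t]
      · rw [if_pos ⟨le_rfl, rfl, fun s h1 h2 => absurd h1 (not_le.2 h2)⟩]
      · intro s _ hs
        refine if_neg ?_
        rintro ⟨h1, -, h2⟩
        exact absurd (h2 t le_rfl (lt_of_le_of_ne h1 (Ne.symm hs))) (by simp [obedient])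
      · simp
    have hd : ∀ s θ, d.hires s θ (fun _ => true) = d.hires s θ₀ (fun _ => true) :=
      fun s θ => d.adapted _ _ _ _ _ ⟨fun _ _ => rfl, by simp⟩
    have hK : ∀ s, ∑ θ : Equiv.Perm (Fin n), ρ (θ s) = ∑ θ : Equiv.Perm (Fin n), ρ (θ t) := by
      intro s
      exact Fintype.sum_equiv (Equiv.mulRight (Equiv.swap s t)) _ _ (by simp)
    simp only [hob]
    unfold payoffFrom
    simp only [hd]
    rw [Finset.sum_comm]
    by_cases hex : ∃ s, t ≤ s ∧ d.hires s θ₀ (fun _ => true) = true ∧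
        ∀ r, t ≤ r → r < s → d.hires r θ₀ (fun _ => true) = false
    · obtain ⟨s, hs⟩ := hex
      rw [Finset.sum_eq_single s]
      · simp only [if_pos hs]
        exact (hK s).le
      · intro r _ hr
        have : ¬ (t ≤ r ∧ d.hires r θ₀ (fun _ => true) = true ∧
            ∀ q, t ≤ q → q < r → d.hires q θ₀ (fun _ => true) = false) := by
          rintro ⟨h1, h2, h3⟩
          rcases lt_or_gt_of_ne hr with h | h
          · simpa [h2] using hs.2.2 r h1 h
          · simpa [hs.2.1] using h3 s hs.1 h
        simp [if_neg this]
      · simp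
    · push Not at hex
      have : ∀ r, ¬ (t ≤ r ∧ d.hires r θ₀ (fun _ => true) = true ∧
            ∀ q, t ≤ q → q < r → d.hires q θ₀ (fun _ => true) = false) := by
        rintro r ⟨h1, h2, h3⟩
        obtain ⟨q, h4, h5, h6⟩ := hex r h1 h2
        exact h6 (h3 q h4 h5)
      simp only [if_neg (this _), Finset.sum_const_zero]
      exact Finset.sum_nonneg fun θ _ => hρ _
  have red : ∀ d : ReceiverStrategy n false, utilityAt ρ (alwaysHire n) d t θ₀ σ₀ =
      if (∀ s, s ≤ t → σ₀ s = true) then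
        1 / (n.factorial : ℝ) * ∑ θ, payoffFrom ρ d t θ (fun _ => true) else 0 := by
    intro d
    unfold utilityAt
    have : ∀ θ, (∑ σ, if SameInfo false t θ₀ θ σ₀ σ then
        (alwaysHire n).law θ σ * payoffFrom ρ d t θ σ else 0) =
        if (∀ s, s ≤ t → σ₀ s = true) then
          1 / (n.factorial : ℝ) * payoffFrom ρ d t θ (fun _ => true) else 0 := by
      intro θ
      rw [Finset.sum_eq_single (fun _ => true)]
      · simp [SameInfo, law_alwaysHire]
      · intro σ _ hσ
        simp [law_alwaysHire, hσ]
      · simp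
    simp only [this]
    split_ifs
    · rw [Finset.mul_sum]
    · simp
  rw [red, red]
  split_ifs
  · exact mul_le_mul_of_nonneg_left key (by positivity)
  · exact le_rfl

theorem bddAbove_benchmarkValues {n : ℕ} (ρ ξ : Fin n → ℝ) : BddAbove (benchmarkValues ρ ξ) := by
  refine ⟨∑ _θ : Equiv.Perm (Fin n), ∑ _σ : Fin n → Bool, ∑ i, |ξ i|, ?_⟩
  rintro _ ⟨φ, -, rfl⟩
  refine Finset.sum_le_sum fun θ _ => Finset.sum_le_sum fun σ _ => ?_
  have hp : ∀ t, 0 ≤ (if σ t = true then φ.hireProb t θ σ else 1 - φ.hireProb t θ σ) ∧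
      (if σ t = true then φ.hireProb t θ σ else 1 - φ.hireProb t θ σ) ≤ 1 := by
    intro t
    have h1 := φ.nonneg t θ σ
    have h2 := φ.le_one t θ σ
    split_ifs <;> constructor <;> linarith
  have hfac : (1 : ℝ) ≤ n.factorial := by exact_mod_cast n.factorial_pos
  have h0 : 0 ≤ φ.law θ σ :=
    mul_nonneg (by positivity) (Finset.prod_nonneg fun t _ => (hp t).1)
  have h1 : φ.law θ σ ≤ 1 :=
    mul_le_one₀ ((div_le_one (by linarith)).2 hfac) (Finset.prod_nonneg fun t _ => (hp t).1)
      (Finset.prod_le_one (fun t _ => (hp t).1) fun t _ => (hp t).2)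
  have h2 : obedientPayoff ξ θ σ ≤ ∑ i, |ξ i| := by
    rw [← Equiv.sum_comp θ]
    refine Finset.sum_le_sum fun t _ => ?_
    split_ifs
    · exact le_abs_self _
    · exact abs_nonneg _
  have h3 : 0 ≤ ∑ i, |ξ i| := Finset.sum_nonneg fun i _ => abs_nonneg _
  nlinarith

/-- The benchmark optimum is the least upper bound of the values of persuasive mechanisms. -/
theorem isLUB_benchmarkOpt {n : ℕ} (ρ ξ : Fin n → ℝ) (hρ : ∀ i, 0 ≤ ρ i) :
    IsLUB (benchmarkValues ρ ξ) (benchmarkOpt ρ ξ) :=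
  isLUB_csSup ⟨_, alwaysHire n, persuasive_alwaysHire ρ hρ, rfl⟩ (bddAbove_benchmarkValues ρ ξ)

end OnlinePersuasion

/-!
The expected pair of utilities of a persuasive benchmark mechanism is dominated by a point of the
hull of all candidates whose receiver coordinate is at least the mean, because the receiver may
always hire the first candidate. The Pareto procedure maximizes the sender coordinate among these
points; write `V C` for this maximum over the candidates in `C`. Hence `OPT ≤ V [n]`.

Let `q i` be the probability that the procedure returns `i` on `C`, with `|C| = m`. Removing a
candidate `i` other than `a` and `b` leaves the chosen point in the hull, but may raise the mean
above its receiver coordinate `r`. Moving towards the best remaining candidate for the receiver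
makes up for this, at the cost of a fraction of `V C`: the share of `i` in the total deficit
`∑ j, max 0 (r - ρ j)`. The shares sum to at most one, and removing `a` or `b` costs at most `V C`
each, so `∑ i, (1 - q i) * V (C \ {i}) ≥ (m - 3) * V C`. By induction on `m`, the mechanism run on
`C` gives the sender at least `V C / 3`: the `m - 3` and the `V C` earned in the first round on
average over `m` arrivals add up without an error term.

For persuasiveness, let `μ` be the mean of `C` and `μ i` the mean of `C \ {i}`. As
`μ i - ρ i = m / (m - 1) * (μ - ρ i)` and the returned candidate is on average at least as good as
`μ`, averaging with weights `q i` shows that after HIRE the current candidate is at least as good as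
a fresh one, and averaging with weights `1 - q i` shows the opposite after NOT.
-/

namespace OnlinePersuasion

open Filter Topology
open scoped BigOperators

variable {n : ℕ}

theorem le_of_forall_not_lt_and_lt {E : Type*} [AddCommGroup E] [Module ℝ E] {s : Set E}
    {f g : E → ℝ} (hf : ConcaveOn ℝ s f) (hg : ConcaveOn ℝ s g) {p q z : E}
    (hp : ∀ x ∈ s, ¬ (f p < f x ∧ g p < g x)) (hq : q ∈ s) (hz : z ∈ s) (hpq : f p ≤ f q)
    (hpz : f p < f z) : g q ≤ g p := by
  by_contra! hlt
  have htendsto : Tendsto (fun ε : ℝ => (1 - ε) * g q + ε * g z) (𝓝[>] 0) (𝓝 (g q)) := by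
    refine (Continuous.tendsto' (by fun_prop) 0 _ (by simp)).mono_left nhdsWithin_le_nhds
  obtain ⟨ε, hgε, hε⟩ := ((htendsto.eventually_const_lt hlt).and
    (Ioo_mem_nhdsGT (zero_lt_one' ℝ))).exists
  have hε₀ : 0 ≤ 1 - ε := sub_nonneg.2 hε.2.le
  have hsum : 1 - ε + ε = 1 := sub_add_cancel 1 ε
  refine hp _ (hf.1 hq hz hε₀ hε.1.le hsum) ⟨?_, hgε.trans_le (hg.2 hq hz hε₀ hε.1.le hsum)⟩
  calc f p = (1 - ε) * f p + ε * f p := by ring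
    _ < (1 - ε) * f q + ε * f z :=
        add_lt_add_of_le_of_lt (mul_le_mul_of_nonneg_left hpq hε₀) (mul_lt_mul_of_pos_left hpz hε.1)
    _ ≤ f ((1 - ε) • q + ε • z) := hf.2 hq hz hε₀ hε.1.le hsum

section Erase

variable {ι : Type*} {f : ι → ℝ} {r x : ℝ} {C : Finset ι} {i : ι}

/-- The share of `i` in the total amount by which the values of `f` on `C` fall short of `r`; it is
`0` if none of them does. -/
noncomputable def deficitShare (f : ι → ℝ) (r : ℝ) (C : Finset ι) (i : ι) : ℝ :=
  (r - f i)⁺ / ∑ j ∈ C, (r - f j)⁺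

theorem deficitShare_nonneg : 0 ≤ deficitShare f r C i :=
  div_nonneg (posPart_nonneg _) (Finset.sum_nonneg fun _ _ => posPart_nonneg _)

theorem sum_deficitShare_le_one : ∑ i ∈ C, deficitShare f r C i ≤ 1 := by
  simp only [deficitShare, ← Finset.sum_div]
  exact div_self_le_one _

theorem deficitShare_le_one (hi : i ∈ C) : deficitShare f r C i ≤ 1 :=
  (Finset.single_le_sum (f := deficitShare f r C) (fun _ _ => deficitShare_nonneg) hi).trans
    sum_deficitShare_le_one

theorem deficitShare_mul_sum (hi : i ∈ C) :
    deficitShare f r C i * ∑ j ∈ C, (r - f j)⁺ = (r - f i)⁺ := by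
  refine div_mul_cancel_of_imp fun h => ?_
  exact (Finset.sum_eq_zero_iff_of_nonneg fun _ _ => posPart_nonneg _).1 h i hi

variable [DecidableEq ι]

theorem expect_erase_le_of_le (hr : 𝔼 j ∈ C, f j ≤ r) (hi : i ∈ C) (hne : (C.erase i).Nonempty)
    (hx : ∀ j ∈ C.erase i, f j ≤ x) (hrx : r ≤ x) :
    𝔼 j ∈ C.erase i, f j ≤ (1 - deficitShare f r C i) * r + deficitShare f r C i * x := by
  set s := deficitShare f r C i
  have hs₀ : 0 ≤ s := deficitShare_nonneg
  have hs₁ : s ≤ 1 := deficitShare_le_one hi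
  set surplus := ∑ j ∈ C.erase i, (f j - r)⁺
  set deficit := ∑ j ∈ C, (r - f j)⁺
  have hsplit (j : ι) : f j - r = (f j - r)⁺ - (r - f j)⁺ := by
    rw [← neg_sub (f j) r, posPart_neg, posPart_sub_negPart]
  have hsurplus_le_deficit : surplus ≤ deficit := by
    have hsum : ∑ j ∈ C, (f j - r) ≤ 0 := by
      rw [Finset.sum_sub_distrib, ← Finset.card_smul_expect, Finset.sum_const, ← smul_sub]
      exact smul_nonpos_of_nonneg_of_nonpos (Nat.zero_le _) (sub_nonpos.2 hr)
    rw [Finset.sum_congr rfl fun j _ => hsplit j, Finset.sum_sub_distrib] at hsum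
    exact (Finset.sum_le_sum_of_subset_of_nonneg (Finset.erase_subset i C)
      fun _ _ _ => posPart_nonneg _).trans (sub_nonpos.1 hsum)
  have hsum_erase : ∑ j ∈ C.erase i, (f j - r) = surplus - (1 - s) * deficit := by
    rw [Finset.sum_congr rfl fun j _ => hsplit j, Finset.sum_sub_distrib,
      Finset.sum_erase_eq_sub (f := fun j => (r - f j)⁺) hi, ← deficitShare_mul_sum hi]
    ring
  have hsurplus_le : surplus ≤ (C.erase i).card • (x - r) :=
    Finset.sum_le_card_nsmul _ _ _ fun j hj =>
      sup_le (sub_le_sub_right (hx j hj) r) (sub_nonneg.2 hrx)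
  have hmean : 𝔼 j ∈ C.erase i, (f j - r) ≤ s * (x - r) := by
    rw [Finset.expect_eq_sum_div_card, hsum_erase,
      div_le_iff₀ (by exact_mod_cast hne.card_pos)]
    rw [nsmul_eq_mul] at hsurplus_le
    nlinarith
  rw [Finset.expect_sub_distrib, Finset.expect_const hne] at hmean
  linarith

theorem expect_erase_sub_self (hC : C.Nontrivial) (hi : i ∈ C) :
    𝔼 j ∈ C.erase i, f j - f i = C.card / (C.card - 1) * (𝔼 j ∈ C, f j - f i) := by
  have hcard : (1 : ℝ) < C.card := by exact_mod_cast Finset.one_lt_card_iff_nontrivial.2 hC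
  rw [Finset.expect_eq_sum_div_card, Finset.expect_eq_sum_div_card, Finset.card_erase_of_mem hi,
    Nat.cast_pred (Finset.card_pos.2 ⟨i, hi⟩), Finset.sum_erase_eq_sub hi]
  have h1 : (C.card : ℝ) - 1 ≠ 0 := by linarith
  have h2 : (C.card : ℝ) ≠ 0 := by linarith
  field_simp
  ring

theorem expect_mul_expect_erase_sub (w : ι → ℝ) (hC : C.Nontrivial) :
    𝔼 i ∈ C, w i * 𝔼 j ∈ C.erase i, f j - 𝔼 i ∈ C, w i * f i =
      C.card / (C.card - 1) * ((𝔼 i ∈ C, w i) * 𝔼 i ∈ C, f i - 𝔼 i ∈ C, w i * f i) := by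
  rw [Finset.expect_mul, ← Finset.expect_sub_distrib, ← Finset.expect_sub_distrib,
    Finset.mul_expect]
  refine Finset.expect_congr rfl fun i hi => ?_
  rw [← mul_sub, expect_erase_sub_self hC hi]
  ring

theorem expect_mul_expect_erase_le {w : ι → ℝ} (hw : ∀ i ∈ C, 0 ≤ w i) (hf : ∀ i ∈ C, 0 ≤ f i)
    (h : (𝔼 i ∈ C, w i) * 𝔼 i ∈ C, f i ≤ 𝔼 i ∈ C, w i * f i) :
    𝔼 i ∈ C, w i * 𝔼 j ∈ C.erase i, f j ≤ 𝔼 i ∈ C, w i * f i := by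
  rcases C.eq_empty_or_nonempty with rfl | ⟨k, hk⟩
  · simp
  rcases C.eq_singleton_or_nontrivial hk with rfl | hC
  · simpa using mul_nonneg (hw k hk) (hf k hk)
  · have hcard : (1 : ℝ) < C.card := by exact_mod_cast Finset.one_lt_card_iff_nontrivial.2 hC
    rw [← sub_nonpos, expect_mul_expect_erase_sub w hC]
    exact mul_nonpos_of_nonneg_of_nonpos (div_nonneg (by linarith) (by linarith)) (sub_nonpos.2 h)

theorem le_expect_mul_expect_erase {w : ι → ℝ} (hC : C.Nontrivial)
    (h : 𝔼 i ∈ C, w i * f i ≤ (𝔼 i ∈ C, w i) * 𝔼 i ∈ C, f i) :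
    𝔼 i ∈ C, w i * f i ≤ 𝔼 i ∈ C, w i * 𝔼 j ∈ C.erase i, f j := by
  have hcard : (1 : ℝ) < C.card := by exact_mod_cast Finset.one_lt_card_iff_nontrivial.2 hC
  rw [← sub_nonneg, expect_mul_expect_erase_sub w hC]
  exact mul_nonneg (div_nonneg (by linarith) (by linarith)) (sub_nonneg.2 h)

end Erase

/-! ### Optimality of the Pareto procedure -/

section Hull

variable {ρ ξ : Fin n → ℝ} {C : Finset (Fin n)} {p q z : ℝ × ℝ} {i : Fin n} {x : ℝ}

theorem mem_valuationHull (hi : i ∈ C) : (ρ i, ξ i) ∈ valuationHull ρ ξ C :=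
  subset_convexHull ℝ _ (Set.mem_image_of_mem _ hi)

theorem convex_valuationHull : Convex ℝ (valuationHull ρ ξ C) := convex_convexHull ℝ _

theorem snd_le_of_mem_valuationHull (hx : ∀ i ∈ C, ξ i ≤ x) (hq : q ∈ valuationHull ρ ξ C) :
    q.2 ≤ x :=
  convexHull_min (by rintro _ ⟨i, hi, rfl⟩; exact hx i hi)
    (convex_halfSpace_le (LinearMap.snd ℝ ℝ ℝ).isLinear x) hq

theorem snd_le_snd_of_mem_paretoFrontier (hp : p ∈ paretoFrontier ρ ξ C)
    (hq : q ∈ valuationHull ρ ξ C) (hz : z ∈ valuationHull ρ ξ C) (hpq : p.1 ≤ q.1)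
    (hpz : p.1 < z.1) : q.2 ≤ p.2 :=
  le_of_forall_not_lt_and_lt ((LinearMap.fst ℝ ℝ ℝ).concaveOn convex_valuationHull)
    ((LinearMap.snd ℝ ℝ ℝ).concaveOn convex_valuationHull) hp.2 hq hz hpq hpz

theorem fst_le_fst_of_mem_paretoFrontier (hp : p ∈ paretoFrontier ρ ξ C)
    (hq : q ∈ valuationHull ρ ξ C) (hz : z ∈ valuationHull ρ ξ C) (hpq : p.2 ≤ q.2)
    (hpz : p.2 < z.2) : q.1 ≤ p.1 :=
  le_of_forall_not_lt_and_lt ((LinearMap.snd ℝ ℝ ℝ).concaveOn convex_valuationHull)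
    ((LinearMap.fst ℝ ℝ ℝ).concaveOn convex_valuationHull)
    (fun x hx h => hp.2 x hx h.symm) hq hz hpq hpz

theorem receiverMean_eq_expect : receiverMean ρ C = 𝔼 i ∈ C, ρ i :=
  (Finset.expect_eq_sum_div_card ..).symm

theorem exists_receiverMean_lt (hi : i ∈ C) (h : ρ i < receiverMean ρ C) :
    ∃ j ∈ C, receiverMean ρ C < ρ j := by
  by_contra! hle
  have hlt : ∑ j ∈ C, ρ j < ∑ _j ∈ C, receiverMean ρ C := Finset.sum_lt_sum hle ⟨i, hi, h⟩
  rw [receiverMean_eq_expect, Finset.sum_const, Finset.card_smul_expect] at hlt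
  exact hlt.false

end Hull

namespace ParetoProcedure

variable {ρ ξ : Fin n → ℝ} (P : ParetoProcedure ρ ξ) {C : Finset (Fin n)} {i : Fin n}
  {u : Fin n → ℝ}

theorem a_mem (hC : C.Nonempty) : P.a C ∈ C := by
  obtain ⟨c, hc, -, ⟨-, ha, -⟩ | ⟨-, ha, -⟩⟩ := P.isParetoPair C hC
  exacts [ha ▸ hc, ha]

theorem b_mem (hC : C.Nonempty) : P.b C ∈ C := by
  obtain ⟨c, hc, -, ⟨-, -, hb⟩ | ⟨-, -, hb, -⟩⟩ := P.isParetoPair C hC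
  exacts [hb ▸ hc, hb]

theorem alpha_nonneg (hC : C.Nonempty) : 0 ≤ P.alpha C := (P.alpha_mem C hC).1

theorem alpha_le_one (hC : C.Nonempty) : P.alpha C ≤ 1 := (P.alpha_mem C hC).2

theorem returnProb_nonneg (hi : i ∈ C) : 0 ≤ P.returnProb C i := (P.returnProb_mem C ⟨i, hi⟩ i).1

theorem returnProb_le_one (hi : i ∈ C) : P.returnProb C i ≤ 1 := (P.returnProb_mem C ⟨i, hi⟩ i).2

/-- The expected utility `u` of the candidate that the procedure returns on input `C`. -/
noncomputable def returned (u : Fin n → ℝ) (C : Finset (Fin n)) : ℝ :=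
  ∑ i ∈ C, P.returnProb C i * u i

theorem returned_eq (hC : C.Nonempty) (u : Fin n → ℝ) :
    P.returned u C = P.alpha C * u (P.a C) + (1 - P.alpha C) * u (P.b C) := by
  simp [returned, returnProb, add_mul, ite_mul, Finset.sum_add_distrib, P.a_mem hC, P.b_mem hC]

theorem sum_returnProb (hC : C.Nonempty) : ∑ i ∈ C, P.returnProb C i = 1 := by
  simpa [returned] using P.returned_eq hC fun _ => 1

theorem returned_nonneg (hu : ∀ i, 0 ≤ u i) : 0 ≤ P.returned u C :=
  Finset.sum_nonneg fun i hi => mul_nonneg (P.returnProb_nonneg hi) (hu i)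

theorem returned_mem_segment (hC : C.Nonempty) :
    (P.returned ρ C, P.returned ξ C) ∈
      segment ℝ (ρ (P.a C), ξ (P.a C)) (ρ (P.b C), ξ (P.b C)) :=
  ⟨P.alpha C, 1 - P.alpha C, P.alpha_nonneg hC, sub_nonneg.2 (P.alpha_le_one hC), by ring, by
    simp [P.returned_eq hC]⟩

theorem returned_eq_receiverMean (hC : C.Nonempty) (ha : ρ (P.a C) ≤ receiverMean ρ C)
    (hb : receiverMean ρ C ≤ ρ (P.b C))
    (hab : ρ (P.a C) = ρ (P.b C) ∨ ξ (P.a C) ≠ ξ (P.b C)) :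
    P.returned ρ C = receiverMean ρ C := by
  rw [P.returned_eq hC, alpha]
  split_ifs with hρ hξ
  · linarith
  · exact absurd hξ (hab.resolve_left hρ)
  · have := sub_ne_zero.2 hρ
    field_simp
    ring

theorem receiverMean_le_returned (hC : C.Nonempty) : receiverMean ρ C ≤ P.returned ρ C := by
  obtain ⟨c, -, -, ⟨hc, ha, hb⟩ | ⟨-, -, -, ha, hb, -⟩⟩ := P.isParetoPair C hC
  · rw [P.returned_eq hC, ha, hb]
    linarith
  by_cases hab : ρ (P.a C) = ρ (P.b C) ∨ ξ (P.a C) ≠ ξ (P.b C)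
  · exact (P.returned_eq_receiverMean hC ha hb hab).ge
  · have hα : P.alpha C = 0 := by
      push Not at hab
      rw [alpha, if_neg hab.1, if_pos hab.2]
    simpa [P.returned_eq hC, hα] using hb

/-- If the segment is horizontal, its right end is sender-optimal: otherwise moving from it
slightly towards a sender-optimal candidate would improve on its left end for both players. -/
theorem snd_le_returned (hC : C.Nonempty) {q : ℝ × ℝ} (hq : q ∈ valuationHull ρ ξ C)
    (hmean : receiverMean ρ C ≤ q.1) : q.2 ≤ P.returned ξ C := by
  obtain ⟨c, hcC, hc, ⟨-, ha, hb⟩ | ⟨hcμ, -, hbC, ha, hb, hseg⟩⟩ := P.isParetoPair C hC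
  · have hreturned : P.returned ξ C = ξ c := by
      rw [P.returned_eq hC, ha, hb]
      ring
    exact hreturned ▸ snd_le_of_mem_valuationHull hc hq
  by_cases hab : ρ (P.a C) = ρ (P.b C) ∨ ξ (P.a C) ≠ ξ (P.b C)
  · have hreturned := P.returned_eq_receiverMean hC ha hb hab
    obtain ⟨j, hj, hμj⟩ := exists_receiverMean_lt hcC hcμ
    exact snd_le_snd_of_mem_paretoFrontier (hseg (P.returned_mem_segment hC)) hq
      (mem_valuationHull hj) (hreturned.trans_le hmean) (hreturned.trans_lt hμj)
  · push Not at hab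
    have hreturned : P.returned ξ C = ξ (P.b C) := by
      rw [P.returned_eq hC, hab.2]
      ring
    have hcb : ξ c ≤ ξ (P.b C) := by
      by_contra! hlt
      have hle := fst_le_fst_of_mem_paretoFrontier (hseg (left_mem_segment ℝ _ _))
        (mem_valuationHull hbC) (mem_valuationHull hcC) hab.2.le (hab.2.trans_lt hlt)
      exact hab.1 (le_antisymm (ha.trans hb) hle)
    exact hreturned ▸ snd_le_of_mem_valuationHull (fun i hi => (hc i hi).trans hcb) hq

theorem returnProb_eq_zero (ha : i ≠ P.a C) (hb : i ≠ P.b C) : P.returnProb C i = 0 := by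
  simp [returnProb, ha, hb]

theorem returned_erase_ge (hξ : ∀ i, 0 ≤ ξ i) (hi : i ∈ C) (ha : i ≠ P.a C) (hb : i ≠ P.b C) :
    (1 - deficitShare ρ (P.returned ρ C) C i) * P.returned ξ C ≤ P.returned ξ (C.erase i) := by
  have hC : C.Nonempty := ⟨i, hi⟩
  have haE : P.a C ∈ C.erase i := Finset.mem_erase.2 ⟨ha.symm, P.a_mem hC⟩
  have hbE : P.b C ∈ C.erase i := Finset.mem_erase.2 ⟨hb.symm, P.b_mem hC⟩
  have hE : (C.erase i).Nonempty := ⟨_, haE⟩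
  obtain ⟨z, hz, hzmax⟩ := (C.erase i).exists_max_image ρ hE
  have hrz : P.returned ρ C ≤ ρ z := by
    rw [P.returned_eq hC]
    nlinarith [hzmax _ haE, hzmax _ hbE, P.alpha_nonneg hC, P.alpha_le_one hC]
  have hreturned : (P.returned ρ C, P.returned ξ C) ∈ valuationHull ρ ξ (C.erase i) :=
    convex_valuationHull.segment_subset (mem_valuationHull haE) (mem_valuationHull hbE)
      (P.returned_mem_segment hC)
  set s := deficitShare ρ (P.returned ρ C) C i
  have hmix := convex_valuationHull hreturned (mem_valuationHull hz)
    (sub_nonneg.2 (deficitShare_le_one hi)) deficitShare_nonneg (sub_add_cancel 1 s)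
  have hmean : receiverMean ρ (C.erase i) ≤ (1 - s) * P.returned ρ C + s * ρ z := by
    rw [receiverMean_eq_expect]
    exact expect_erase_le_of_le (receiverMean_eq_expect.ge.trans (P.receiverMean_le_returned hC))
      hi hE hzmax hrz
  calc (1 - s) * P.returned ξ C
      ≤ (1 - s) * P.returned ξ C + s * ξ z :=
        le_add_of_nonneg_right (mul_nonneg deficitShare_nonneg (hξ z))
    _ ≤ P.returned ξ (C.erase i) := P.snd_le_returned hE hmix hmean

theorem card_sub_three_mul_returned_le (hξ : ∀ i, 0 ≤ ξ i) (hC : C.Nonempty) :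
    (C.card - 3) * P.returned ξ C ≤
      ∑ i ∈ C, (1 - P.returnProb C i) * P.returned ξ (C.erase i) := by
  have hV : 0 ≤ P.returned ξ C := P.returned_nonneg hξ
  set s := deficitShare ρ (P.returned ρ C) C
  have hterm (i : Fin n) (hi : i ∈ C) :
      (1 - s i - (if i = P.a C then 1 else 0) - (if i = P.b C then 1 else 0)) * P.returned ξ C ≤
        (1 - P.returnProb C i) * P.returned ξ (C.erase i) := by
    by_cases hab : i = P.a C ∨ i = P.b C
    · refine (mul_nonpos_of_nonpos_of_nonneg ?_ hV).trans
        (mul_nonneg (sub_nonneg.2 (P.returnProb_le_one hi)) (P.returned_nonneg hξ))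
      have hs : 0 ≤ s i := deficitShare_nonneg
      rcases hab with h | h <;> rw [if_pos h] <;> split_ifs <;> linarith
    · push Not at hab
      rw [P.returnProb_eq_zero hab.1 hab.2, if_neg hab.1, if_neg hab.2]
      simpa using P.returned_erase_ge hξ hi hab.1 hab.2
  refine le_trans ?_ (Finset.sum_le_sum hterm)
  rw [← Finset.sum_mul]
  refine mul_le_mul_of_nonneg_right ?_ hV
  have hs : ∑ i ∈ C, s i ≤ 1 := sum_deficitShare_le_one
  simp only [Finset.sum_sub_distrib, Finset.sum_const, nsmul_eq_mul, mul_one,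
    Finset.sum_ite_eq', P.a_mem hC, P.b_mem hC, if_true]
  linarith

/-- The expected utility `u` of the candidate hired when the candidates of `C` arrive in uniformly
random order, each is hired if the procedure returns it on the set of those that remain, and the
receiver obeys; it is defined by recursion over the first arrival. -/
noncomputable def value (u : Fin n → ℝ) (C : Finset (Fin n)) : ℝ :=
  𝔼 i ∈ C.attach, (P.returnProb C i * u i + (1 - P.returnProb C i) * value u (C.erase i))
termination_by C.card
decreasing_by exact Finset.card_erase_lt_of_mem i.2

theorem value_eq (u : Fin n → ℝ) (C : Finset (Fin n)) : P.value u C =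
    𝔼 i ∈ C, (P.returnProb C i * u i + (1 - P.returnProb C i) * P.value u (C.erase i)) := by
  rw [value, Finset.expect_eq_sum_div_card, Finset.expect_eq_sum_div_card, Finset.card_attach,
    Finset.sum_attach C fun i =>
      P.returnProb C i * u i + (1 - P.returnProb C i) * P.value u (C.erase i)]

theorem value_empty (u : Fin n → ℝ) : P.value u ∅ = 0 := by rw [value_eq, Finset.expect_empty]

theorem returned_le_three_mul_value (hξ : ∀ i, 0 ≤ ξ i) (C : Finset (Fin n)) :
    P.returned ξ C ≤ 3 * P.value ξ C := by
  induction C using Finset.strongInduction with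
  | H C ih =>
    rcases C.eq_empty_or_nonempty with rfl | hC
    · simp [returned, value_empty]
    have hcard : (0 : ℝ) < C.card := by exact_mod_cast hC.card_pos
    refine le_of_mul_le_mul_left ?_ hcard
    calc C.card * P.returned ξ C
        = 3 * P.returned ξ C + (C.card - 3) * P.returned ξ C := by ring
      _ ≤ 3 * P.returned ξ C +
            ∑ i ∈ C, (1 - P.returnProb C i) * P.returned ξ (C.erase i) := by
          gcongr
          exact P.card_sub_three_mul_returned_le hξ hC
      _ ≤ 3 * P.returned ξ C +
            ∑ i ∈ C, (1 - P.returnProb C i) * (3 * P.value ξ (C.erase i)) := by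
          gcongr with i hi
          · exact sub_nonneg.2 (P.returnProb_le_one hi)
          · exact ih _ (Finset.erase_ssubset hi)
      _ = 3 * ∑ i ∈ C, (P.returnProb C i * ξ i +
            (1 - P.returnProb C i) * P.value ξ (C.erase i)) := by
          simp only [returned, Finset.sum_add_distrib, mul_add, Finset.mul_sum]
          ring_nf
      _ = C.card * (3 * P.value ξ C) := by
          rw [value_eq, ← Finset.card_smul_expect, nsmul_eq_mul]
          ring

theorem expect_returnProb_mul_receiverMean_le (C : Finset (Fin n)) :
    (𝔼 i ∈ C, P.returnProb C i) * 𝔼 i ∈ C, ρ i ≤ 𝔼 i ∈ C, P.returnProb C i * ρ i := by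
  rcases C.eq_empty_or_nonempty with rfl | hC
  · simp
  rw [← receiverMean_eq_expect (ρ := ρ), Finset.expect_eq_sum_div_card, P.sum_returnProb hC,
    Finset.expect_eq_sum_div_card, div_mul_eq_mul_div, one_mul]
  exact div_le_div_of_nonneg_right (P.receiverMean_le_returned hC) (Nat.cast_nonneg _)

theorem expect_returnProb_mul_receiverMean_erase_le (hρ : ∀ i, 0 ≤ ρ i) (C : Finset (Fin n)) :
    𝔼 i ∈ C, P.returnProb C i * receiverMean ρ (C.erase i) ≤
      𝔼 i ∈ C, P.returnProb C i * ρ i := by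
  simp only [receiverMean_eq_expect]
  exact expect_mul_expect_erase_le (fun i hi => P.returnProb_nonneg hi) (fun i _ => hρ i)
    (P.expect_returnProb_mul_receiverMean_le C)

theorem expect_le_expect_mul_receiverMean_erase (C : Finset (Fin n)) :
    𝔼 i ∈ C, (1 - P.returnProb C i) * ρ i ≤
      𝔼 i ∈ C, (1 - P.returnProb C i) * receiverMean ρ (C.erase i) := by
  rcases C.eq_empty_or_nonempty with rfl | ⟨k, hk⟩
  · simp
  rcases C.eq_singleton_or_nontrivial hk with rfl | hC
  · have hreturn : P.returnProb {k} k = 1 := by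
      simpa using P.sum_returnProb (Finset.singleton_nonempty k)
    simp [hreturn]
  · simp only [receiverMean_eq_expect]
    refine le_expect_mul_expect_erase hC ?_
    have h := P.expect_returnProb_mul_receiverMean_le C
    simp only [sub_mul, one_mul, Finset.expect_sub_distrib, Finset.expect_const ⟨k, hk⟩]
    linarith

theorem receiverMean_le_value (C : Finset (Fin n)) : receiverMean ρ C ≤ P.value ρ C := by
  induction C using Finset.strongInduction with
  | H C ih =>
    calc receiverMean ρ C
        = 𝔼 i ∈ C, P.returnProb C i * ρ i + 𝔼 i ∈ C, (1 - P.returnProb C i) * ρ i := by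
          rw [receiverMean_eq_expect, ← Finset.expect_add_distrib]
          exact Finset.expect_congr rfl fun i _ => by ring
      _ ≤ 𝔼 i ∈ C, P.returnProb C i * ρ i +
            𝔼 i ∈ C, (1 - P.returnProb C i) * receiverMean ρ (C.erase i) := by
          gcongr 1
          exact P.expect_le_expect_mul_receiverMean_erase C
      _ ≤ 𝔼 i ∈ C, P.returnProb C i * ρ i +
            𝔼 i ∈ C, (1 - P.returnProb C i) * P.value ρ (C.erase i) := by
          gcongr 1
          exact Finset.expect_le_expect fun i hi => mul_le_mul_of_nonneg_left
            (ih _ (Finset.erase_ssubset hi)) (sub_nonneg.2 (P.returnProb_le_one hi))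
      _ = P.value ρ C := by rw [value_eq, Finset.expect_add_distrib]

end ParetoProcedure

theorem expect_receiverMean_erase_le {ρ : Fin n → ℝ} (hρ : ∀ i, 0 ≤ ρ i) (C : Finset (Fin n)) :
    𝔼 i ∈ C, receiverMean ρ (C.erase i) ≤ receiverMean ρ C := by
  rcases C.eq_empty_or_nonempty with rfl | hC
  · simp [receiverMean]
  simp only [receiverMean_eq_expect]
  simpa using expect_mul_expect_erase_le (w := fun _ => 1) (C := C) (fun _ _ => zero_le_one)
    (fun i _ => hρ i) (by simp [Finset.expect_const hC])

/-! ### Histories -/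

section Histories

variable {t : Fin n} {θ θ₀ : Equiv.Perm (Fin n)} {σ σ₀ : Fin n → Bool} {i : Fin n}

/-- The candidates that have not arrived in the first `t` rounds. In contrast to `remaining`, it
includes the time `t = n` after the last round. -/
def remainingFrom (t : Fin (n + 1)) (θ : Equiv.Perm (Fin n)) : Finset (Fin n) :=
  {i | ∀ s : Fin n, s.castSucc < t → θ s ≠ i}

theorem mem_remainingFrom {t : Fin (n + 1)} :
    i ∈ remainingFrom t θ ↔ ∀ s : Fin n, s.castSucc < t → θ s ≠ i := by
  simp [remainingFrom]

theorem remainingFrom_zero (θ : Equiv.Perm (Fin n)) : remainingFrom 0 θ = Finset.univ := by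
  simp [remainingFrom]

theorem remainingFrom_eq_map (t : Fin (n + 1)) (θ : Equiv.Perm (Fin n)) :
    remainingFrom t θ = ({s | t ≤ s.castSucc} : Finset (Fin n)).map θ.toEmbedding := by
  ext i
  simp only [mem_remainingFrom, Finset.mem_map_equiv, Finset.mem_filter, Finset.mem_univ, true_and]
  constructor
  · intro h
    by_contra! hlt
    exact h _ hlt (θ.apply_symm_apply i)
  · rintro h s hs rfl
    rw [θ.symm_apply_apply] at h
    exact h.not_gt hs

theorem card_remainingFrom (t : Fin (n + 1)) (θ : Equiv.Perm (Fin n)) :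
    (remainingFrom t θ).card = n - t := by
  have hfilter : ({s | t ≤ s.castSucc} : Finset (Fin n)) =
      (Finset.univ.filter fun s : Fin n => (s : ℕ) < t)ᶜ := by
    ext s
    simp [Fin.le_def]
  rw [remainingFrom_eq_map, Finset.card_map, hfilter, Finset.card_compl, Fintype.card_fin,
    Fin.card_filter_val_lt, min_eq_right t.is_le]

theorem remainingFrom_last (θ : Equiv.Perm (Fin n)) : remainingFrom (Fin.last n) θ = ∅ := by
  simp [← Finset.card_eq_zero, card_remainingFrom]

theorem remainingFrom_castSucc_nonempty (t : Fin n) (θ : Equiv.Perm (Fin n)) :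
    (remainingFrom t.castSucc θ).Nonempty :=
  ⟨θ t, mem_remaining t θ⟩

/-- The arrival order `θ`, changed so that candidate `i` arrives in round `t`; if `i` has not
arrived before, then the earlier rounds stay as they are. -/
def arrive (θ : Equiv.Perm (Fin n)) (t i : Fin n) : Equiv.Perm (Fin n) :=
  θ * Equiv.swap t (θ⁻¹ i)

theorem arrive_self (θ : Equiv.Perm (Fin n)) (t i : Fin n) : arrive θ t i t = i := by
  simp [arrive]

theorem arrive_of_lt {s : Fin n} (hi : i ∈ remainingFrom t.castSucc θ) (hs : s < t) :
    arrive θ t i s = θ s := by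
  have h : s ≠ θ⁻¹ i := fun h => mem_remainingFrom.1 hi s hs (by simp [h])
  rw [arrive, Equiv.Perm.mul_apply, Equiv.swap_apply_of_ne_of_ne hs.ne h]

theorem remainingFrom_congr {t : Fin (n + 1)} (h : ∀ s : Fin n, s.castSucc < t → θ s = θ₀ s) :
    remainingFrom t θ = remainingFrom t θ₀ := by
  ext i
  simp only [mem_remainingFrom]
  exact forall₂_congr fun s hs => by rw [h s hs]

theorem remainingFrom_castSucc_arrive (hi : i ∈ remainingFrom t.castSucc θ) :
    remainingFrom t.castSucc (arrive θ t i) = remainingFrom t.castSucc θ :=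
  remainingFrom_congr fun _ hs => arrive_of_lt hi hs

theorem forall_castSucc_lt_succ_iff {p : Fin n → Prop} :
    (∀ s : Fin n, s.castSucc < t.succ → p s) ↔
      (∀ s : Fin n, s.castSucc < t.castSucc → p s) ∧ p t := by
  simp only [Fin.castSucc_lt_succ_iff, Fin.castSucc_lt_castSucc_iff, le_iff_lt_or_eq, or_imp,
    forall_and, forall_eq]

theorem remainingFrom_succ_arrive (hi : i ∈ remainingFrom t.castSucc θ) :
    remainingFrom t.succ (arrive θ t i) = (remainingFrom t.castSucc θ).erase i := by
  ext j
  rw [mem_remainingFrom, forall_castSucc_lt_succ_iff, ← mem_remainingFrom,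
    remainingFrom_castSucc_arrive hi, arrive_self, Finset.mem_erase, and_comm, ne_comm]

/-- The pairs of an arrival order and a signal vector that agree with `(θ₀, σ₀)` in the first `t`
rounds. -/
def cylinder (t : Fin (n + 1)) (θ₀ : Equiv.Perm (Fin n)) (σ₀ : Fin n → Bool) :
    Finset (Equiv.Perm (Fin n) × (Fin n → Bool)) :=
  {p | ∀ s : Fin n, s.castSucc < t → p.1 s = θ₀ s ∧ p.2 s = σ₀ s}

theorem mem_cylinder {t : Fin (n + 1)} {p : Equiv.Perm (Fin n) × (Fin n → Bool)} :
    p ∈ cylinder t θ₀ σ₀ ↔ ∀ s : Fin n, s.castSucc < t → p.1 s = θ₀ s ∧ p.2 s = σ₀ s := by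
  simp [cylinder]

theorem cylinder_zero : cylinder 0 θ₀ σ₀ = Finset.univ := by
  simp [cylinder]

theorem cylinder_last : cylinder (Fin.last n) θ₀ σ₀ = {(θ₀, σ₀)} := by
  ext p
  simp [mem_cylinder, Fin.castSucc_lt_last, Prod.ext_iff, Equiv.ext_iff, funext_iff, forall_and]

theorem filter_cylinder_castSucc (hi : i ∈ remainingFrom t.castSucc θ₀) (b : Bool) :
    ((cylinder t.castSucc θ₀ σ₀).filter fun p => (p.1 t, p.2 t) = (i, b)) =
      cylinder t.succ (arrive θ₀ t i) (Function.update σ₀ t b) := by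
  ext p
  rw [Finset.mem_filter, mem_cylinder, mem_cylinder, forall_castSucc_lt_succ_iff, arrive_self,
    Function.update_self, Prod.mk.injEq]
  refine and_congr_left fun _ => forall₂_congr fun s hs => ?_
  rw [arrive_of_lt hi hs, Function.update_of_ne (Fin.castSucc_lt_castSucc_iff.1 hs).ne]

theorem apply_mem_remainingFrom_of_mem_cylinder {p : Equiv.Perm (Fin n) × (Fin n → Bool)}
    (hp : p ∈ cylinder t.castSucc θ₀ σ₀) : p.1 t ∈ remainingFrom t.castSucc θ₀ := by
  rw [← remainingFrom_congr fun s hs => (mem_cylinder.1 hp s hs).1]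
  exact mem_remaining t p.1

end Histories

namespace DirectMechanism

variable (φ : DirectMechanism n) {t : Fin n} {θ θ' θ₀ : Equiv.Perm (Fin n)}
  {σ σ' σ₀ : Fin n → Bool} {b : Bool} {f g : Equiv.Perm (Fin n) → (Fin n → Bool) → ℝ}

/-- The probability of the signal `b` in round `t`. -/
noncomputable def signalProb (t : Fin n) (θ : Equiv.Perm (Fin n)) (σ : Fin n → Bool) (b : Bool) :
    ℝ :=
  if b then φ.hireProb t θ σ else 1 - φ.hireProb t θ σ

theorem signalProb_true : φ.signalProb t θ σ true = φ.hireProb t θ σ := rfl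

theorem signalProb_false : φ.signalProb t θ σ false = 1 - φ.hireProb t θ σ := rfl

theorem signalProb_nonneg : 0 ≤ φ.signalProb t θ σ b := by
  cases b
  exacts [sub_nonneg.2 (φ.le_one t θ σ), φ.nonneg t θ σ]

theorem sum_signalProb : ∑ b, φ.signalProb t θ σ b = 1 := by
  simp [signalProb]

theorem signalProb_congr (hθ : ∀ s ≤ t, θ s = θ' s) (hσ : ∀ s < t, σ s = σ' s) :
    φ.signalProb t θ σ b = φ.signalProb t θ' σ' b := by
  simp only [signalProb, φ.causal t θ θ' σ σ' hθ hσ]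

/-- The probability of the signals `σ` from round `t` on, given the arrival order `θ` and the
signals before round `t`. -/
noncomputable def tailProb (t : Fin (n + 1)) (θ : Equiv.Perm (Fin n)) (σ : Fin n → Bool) : ℝ :=
  ∏ s with t ≤ s.castSucc, φ.signalProb s θ σ (σ s)

theorem tailProb_last : φ.tailProb (Fin.last n) θ σ = 1 := by
  simp [tailProb]

theorem tailProb_castSucc :
    φ.tailProb t.castSucc θ σ = φ.signalProb t θ σ (σ t) * φ.tailProb t.succ θ σ := by
  have hinsert : (Finset.univ.filter fun s : Fin n => t.castSucc ≤ s.castSucc) =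
      insert t (Finset.univ.filter fun s : Fin n => t.succ ≤ s.castSucc) := by
    ext s
    rw [Finset.mem_insert, Finset.mem_filter_univ, Finset.mem_filter_univ,
      Fin.castSucc_le_castSucc_iff, Fin.succ_le_castSucc_iff, le_iff_eq_or_lt, eq_comm]
  rw [tailProb, hinsert, Finset.prod_insert (by simp [Fin.succ_le_castSucc_iff]), tailProb]

/-- The conditional expectation of `f`, given that the first `t` rounds are as in `(θ₀, σ₀)`: the
remaining candidates arrive in uniformly random order and `φ` sends the signals. -/
noncomputable def condExp (t : Fin (n + 1)) (θ₀ : Equiv.Perm (Fin n)) (σ₀ : Fin n → Bool)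
    (f : Equiv.Perm (Fin n) → (Fin n → Bool) → ℝ) : ℝ :=
  (∑ p ∈ cylinder t θ₀ σ₀, φ.tailProb t p.1 p.2 * f p.1 p.2) / (n - t : ℕ).factorial

theorem condExp_congr {t : Fin (n + 1)} (h : ∀ p ∈ cylinder t θ₀ σ₀, f p.1 p.2 = g p.1 p.2) :
    φ.condExp t θ₀ σ₀ f = φ.condExp t θ₀ σ₀ g := by
  rw [condExp, Finset.sum_congr rfl fun p hp => by rw [h p hp], condExp]

theorem condExp_last : φ.condExp (Fin.last n) θ₀ σ₀ f = f θ₀ σ₀ := by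
  simp [condExp, cylinder_last, tailProb_last]

theorem signalProb_eq_of_mem_cylinder {i : Fin n}
    {p : Equiv.Perm (Fin n) × (Fin n → Bool)}
    (hp : p ∈ cylinder t.succ (arrive θ₀ t i) (Function.update σ₀ t b)) :
    φ.signalProb t p.1 p.2 (p.2 t) = φ.signalProb t (arrive θ₀ t i) σ₀ b := by
  rw [mem_cylinder] at hp
  have ht := hp t t.castSucc_lt_succ
  rw [ht.2, Function.update_self]
  refine φ.signalProb_congr (fun s hs => (hp s (Fin.castSucc_lt_succ_iff.2 hs)).1) fun s hs => ?_
  rw [(hp s (Fin.castSucc_lt_succ_iff.2 hs.le)).2, Function.update_of_ne hs.ne]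

theorem condExp_castSucc (t : Fin n) (θ₀ : Equiv.Perm (Fin n)) (σ₀ : Fin n → Bool)
    (f : Equiv.Perm (Fin n) → (Fin n → Bool) → ℝ) :
    φ.condExp t.castSucc θ₀ σ₀ f = 𝔼 i ∈ remainingFrom t.castSucc θ₀, ∑ b,
      φ.signalProb t (arrive θ₀ t i) σ₀ b *
        φ.condExp t.succ (arrive θ₀ t i) (Function.update σ₀ t b) f := by
  have hfactorial : (n - t : ℕ).factorial = (n - t.succ : ℕ).factorial * (n - t : ℕ) := by
    rw [Fin.val_succ, ← Nat.sub_sub, mul_comm, Nat.mul_factorial_pred (by omega)]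
  have hfiber : ∀ x ∈ remainingFrom t.castSucc θ₀ ×ˢ Finset.univ,
      ∑ p ∈ cylinder t.castSucc θ₀ σ₀ with (p.1 t, p.2 t) = x,
          φ.tailProb t.castSucc p.1 p.2 * f p.1 p.2 =
        φ.signalProb t (arrive θ₀ t x.1) σ₀ x.2 *
          ∑ p ∈ cylinder t.succ (arrive θ₀ t x.1) (Function.update σ₀ t x.2),
            φ.tailProb t.succ p.1 p.2 * f p.1 p.2 := by
    intro x hx
    have hi := (Finset.mem_product.1 hx).1
    rw [filter_cylinder_castSucc hi, Finset.mul_sum]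
    refine Finset.sum_congr rfl fun p hp => ?_
    rw [tailProb_castSucc, φ.signalProb_eq_of_mem_cylinder hp, mul_assoc]
  rw [condExp, ← Finset.sum_fiberwise_of_maps_to (t := remainingFrom t.castSucc θ₀ ×ˢ Finset.univ)
      (g := fun p => (p.1 t, p.2 t)) fun p hp => Finset.mk_mem_product
        (apply_mem_remainingFrom_of_mem_cylinder hp) (Finset.mem_univ _),
    Finset.sum_congr rfl hfiber, Finset.sum_product, Finset.expect_eq_sum_div_card,
    card_remainingFrom, Fin.val_castSucc, hfactorial, Nat.cast_mul, ← div_div, Finset.sum_div]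
  simp only [condExp, Finset.sum_div, mul_div_assoc]

theorem condExp_const (t : Fin (n + 1)) (θ₀ : Equiv.Perm (Fin n)) (σ₀ : Fin n → Bool) (c : ℝ) :
    φ.condExp t θ₀ σ₀ (fun _ _ => c) = c := by
  induction t using Fin.reverseInduction generalizing θ₀ σ₀ with
  | last => exact φ.condExp_last
  | cast t ih =>
    simp only [condExp_castSucc, ih, ← Finset.sum_mul, sum_signalProb, one_mul]
    exact Finset.expect_const (remainingFrom_castSucc_nonempty t θ₀) c

/-- The probability that the first `t` rounds are as in `(θ₀, σ₀)`. -/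
noncomputable def historyProb (t : Fin (n + 1)) (θ₀ : Equiv.Perm (Fin n)) (σ₀ : Fin n → Bool) : ℝ :=
  (n - t : ℕ).factorial / n.factorial * ∏ s with s.castSucc < t, φ.signalProb s θ₀ σ₀ (σ₀ s)

theorem historyProb_nonneg {t : Fin (n + 1)} : 0 ≤ φ.historyProb t θ₀ σ₀ :=
  mul_nonneg (by positivity) (Finset.prod_nonneg fun _ _ => φ.signalProb_nonneg)

theorem historyProb_zero : φ.historyProb 0 θ₀ σ₀ = 1 := by
  simp [historyProb, Nat.factorial_ne_zero]

theorem law_eq_of_mem_cylinder {t : Fin (n + 1)} {p : Equiv.Perm (Fin n) × (Fin n → Bool)}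
    (hp : p ∈ cylinder t θ₀ σ₀) :
    φ.law p.1 p.2 =
      φ.historyProb t θ₀ σ₀ * (φ.tailProb t p.1 p.2 / (n - t : ℕ).factorial) := by
  have hpast : ∏ s with s.castSucc < t, φ.signalProb s p.1 p.2 (p.2 s) =
      ∏ s with s.castSucc < t, φ.signalProb s θ₀ σ₀ (σ₀ s) := by
    refine Finset.prod_congr rfl fun s hs => ?_
    rw [Finset.mem_filter_univ] at hs
    rw [mem_cylinder] at hp
    rw [(hp s hs).2]
    exact φ.signalProb_congr
      (fun r hr => (hp r ((Fin.castSucc_le_castSucc_iff.2 hr).trans_lt hs)).1)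
      fun r hr => (hp r ((Fin.castSucc_lt_castSucc_iff.2 hr).trans hs)).2
  have hsplit : ∏ s, φ.signalProb s p.1 p.2 (p.2 s) =
      (∏ s with s.castSucc < t, φ.signalProb s p.1 p.2 (p.2 s)) * φ.tailProb t p.1 p.2 := by
    simp only [tailProb, ← not_lt, Finset.prod_filter_mul_prod_filter_not]
  change 1 / (n.factorial : ℝ) * ∏ s, φ.signalProb s p.1 p.2 (p.2 s) = _
  rw [hsplit, hpast, historyProb]
  have := Nat.factorial_ne_zero (n - t)
  field_simp

theorem sum_cylinder_law_mul (t : Fin (n + 1)) (θ₀ : Equiv.Perm (Fin n)) (σ₀ : Fin n → Bool)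
    (f : Equiv.Perm (Fin n) → (Fin n → Bool) → ℝ) :
    ∑ p ∈ cylinder t θ₀ σ₀, φ.law p.1 p.2 * f p.1 p.2 =
      φ.historyProb t θ₀ σ₀ * φ.condExp t θ₀ σ₀ f := by
  rw [condExp, Finset.sum_div, Finset.mul_sum]
  refine Finset.sum_congr rfl fun p hp => ?_
  rw [φ.law_eq_of_mem_cylinder hp]
  ring

theorem sum_law_mul (θ₀ : Equiv.Perm (Fin n)) (σ₀ : Fin n → Bool)
    (f : Equiv.Perm (Fin n) → (Fin n → Bool) → ℝ) :
    ∑ θ, ∑ σ, φ.law θ σ * f θ σ = φ.condExp 0 θ₀ σ₀ f := by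
  have h := φ.sum_cylinder_law_mul 0 θ₀ σ₀ f
  rwa [cylinder_zero, historyProb_zero, one_mul, Fintype.sum_prod_type] at h

theorem law_nonneg (θ : Equiv.Perm (Fin n)) (σ : Fin n → Bool) : 0 ≤ φ.law θ σ :=
  mul_nonneg (by positivity) (Finset.prod_nonneg fun _ _ => φ.signalProb_nonneg)

theorem sum_law : ∑ θ, ∑ σ, φ.law θ σ = 1 := by
  have h := φ.sum_law_mul 1 (fun _ => false) fun _ _ => 1
  simpa only [mul_one, condExp_const] using h

end DirectMechanism

/-! ### Continuation payoffs -/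

section Payoffs

variable {disclosure : Bool} {d : ReceiverStrategy n disclosure} {t : Fin n}
  {θ θ' : Equiv.Perm (Fin n)} {σ σ' : Fin n → Bool}

/-- `payoffFrom`, extended to the time `t₀ = n` after the last round. -/
noncomputable def payoffAfter (u : Fin n → ℝ) (d : ReceiverStrategy n disclosure)
    (t₀ : Fin (n + 1)) (θ : Equiv.Perm (Fin n)) (σ : Fin n → Bool) : ℝ :=
  open Classical in
  ∑ t, if t₀ ≤ t.castSucc ∧ d.hires t θ σ = true ∧
      (∀ s : Fin n, t₀ ≤ s.castSucc → s < t → d.hires s θ σ = false)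
    then u (θ t) else 0

theorem payoffFrom_eq_payoffAfter (u : Fin n → ℝ) (d : ReceiverStrategy n disclosure)
    (t : Fin n) : payoffFrom u d t = payoffAfter u d t.castSucc := rfl

theorem obedientPayoff_eq_payoffAfter (u : Fin n → ℝ) :
    obedientPayoff u = payoffAfter u (obedient n disclosure) 0 := by
  ext θ σ
  simp [obedientPayoff, payoffAfter, obedient]

theorem payoffAfter_last (u : Fin n → ℝ) : payoffAfter u d (Fin.last n) θ σ = 0 :=
  Finset.sum_eq_zero fun t _ => if_neg fun h => h.1.not_gt t.castSucc_lt_last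

theorem payoffAfter_of_hires (u : Fin n → ℝ) (h : d.hires t θ σ = true) :
    payoffAfter u d t.castSucc θ σ = u (θ t) := by
  rw [payoffAfter, Fintype.sum_eq_single t,
    if_pos ⟨le_rfl, h, fun s hts hst => absurd hst hts.not_gt⟩]
  refine fun s hs => if_neg fun ⟨hts, _, hreject⟩ => ?_
  exact Bool.false_ne_true ((hreject t le_rfl (lt_of_le_of_ne hts hs.symm)).symm.trans h)

theorem payoffAfter_of_rejects (u : Fin n → ℝ) (h : d.hires t θ σ = false) :
    payoffAfter u d t.castSucc θ σ = payoffAfter u d t.succ θ σ := by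
  refine Finset.sum_congr rfl fun s _ => if_congr ?_ rfl rfl
  simp only [Fin.succ_le_castSucc_iff, Fin.castSucc_le_castSucc_iff]
  constructor
  · rintro ⟨hts, hs, hreject⟩
    refine ⟨lt_of_le_of_ne hts ?_, hs, fun r hr => hreject r hr.le⟩
    rintro rfl
    exact Bool.false_ne_true (h.symm.trans hs)
  · rintro ⟨hts, hs, hreject⟩
    refine ⟨hts.le, hs, fun r hr hrs => ?_⟩
    rcases hr.eq_or_lt with rfl | hr
    exacts [h, hreject r hr hrs]

theorem ReceiverStrategy.hires_congr (d : ReceiverStrategy n disclosure) (hθ : ∀ s < t, θ s = θ' s)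
    (hσ : ∀ s ≤ t, σ s = σ' s) : d.hires t θ σ = d.hires t θ' σ' :=
  d.adapted t θ θ' σ σ' ⟨hσ, fun _ => hθ⟩

theorem sameInfo_true_iff {p : Equiv.Perm (Fin n) × (Fin n → Bool)} :
    SameInfo true t θ p.1 σ p.2 ↔ p ∈ cylinder t.castSucc θ σ ∧ p.2 t = σ t := by
  simp only [SameInfo, mem_cylinder, Fin.castSucc_lt_castSucc_iff, le_iff_lt_or_eq, or_imp,
    forall_and, forall_eq, true_imp_iff, eq_comm (b := σ _), eq_comm (b := θ _)]
  tauto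

end Payoffs

namespace DirectMechanism

variable {disclosure : Bool} (φ : DirectMechanism n) (u : Fin n → ℝ)
  (d : ReceiverStrategy n disclosure) {t : Fin n} {θ : Equiv.Perm (Fin n)}
  {σ : Fin n → Bool} {i : Fin n}

/-- The conditional expected utility `u` of the candidate that `d` hires from round `t` on, given
that the first `t` rounds are as in `(θ, σ)`. -/
noncomputable def continuationUtility (t : Fin (n + 1)) (θ : Equiv.Perm (Fin n))
    (σ : Fin n → Bool) : ℝ :=
  φ.condExp t θ σ (payoffAfter u d t)

/-- The conditional expected utility `u` of the candidate that `d` hires from round `t` on, given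
the arrivals before round `t`, the signals up to round `t`, and that `i` arrives in round `t`. -/
noncomputable def actUtility (t : Fin n) (θ : Equiv.Perm (Fin n)) (σ : Fin n → Bool) (i : Fin n) :
    ℝ :=
  if d.hires t θ σ then u i else φ.continuationUtility u d t.succ (arrive θ t i) σ

theorem actUtility_of_hires (h : d.hires t θ σ = true) : φ.actUtility u d t θ σ i = u i :=
  if_pos h

theorem actUtility_of_rejects (h : d.hires t θ σ = false) :
    φ.actUtility u d t θ σ i = φ.continuationUtility u d t.succ (arrive θ t i) σ := by
  simp [actUtility, h]

theorem continuationUtility_last : φ.continuationUtility u d (Fin.last n) θ σ = 0 := by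
  rw [continuationUtility, condExp_last, payoffAfter_last]

theorem condExp_succ_payoffAfter_castSucc (hi : i ∈ remainingFrom t.castSucc θ) :
    φ.condExp t.succ (arrive θ t i) σ (payoffAfter u d t.castSucc) =
      φ.actUtility u d t θ σ i := by
  have hhires {p} (hp : p ∈ cylinder t.succ (arrive θ t i) σ) :
      d.hires t p.1 p.2 = d.hires t θ σ := by
    have h := mem_cylinder.1 hp
    refine d.hires_congr (fun s hs => ?_) fun s hs => (h s (Fin.castSucc_lt_succ_iff.2 hs)).2
    rw [(h s (Fin.castSucc_lt_succ_iff.2 hs.le)).1, arrive_of_lt hi hs]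
  cases hd : d.hires t θ σ with
  | true =>
    rw [actUtility_of_hires _ _ _ hd, ← φ.condExp_const t.succ (arrive θ t i) σ (u i)]
    refine φ.condExp_congr fun p hp => ?_
    rw [payoffAfter_of_hires u ((hhires hp).trans hd),
      (mem_cylinder.1 hp t t.castSucc_lt_succ).1, arrive_self]
  | false =>
    rw [actUtility_of_rejects _ _ _ hd, continuationUtility]
    exact φ.condExp_congr fun p hp => payoffAfter_of_rejects u ((hhires hp).trans hd)

theorem continuationUtility_castSucc (t : Fin n) (θ : Equiv.Perm (Fin n)) (σ : Fin n → Bool) :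
    φ.continuationUtility u d t.castSucc θ σ = 𝔼 i ∈ remainingFrom t.castSucc θ, ∑ b,
      φ.signalProb t (arrive θ t i) σ b *
        φ.actUtility u d t θ (Function.update σ t b) i := by
  rw [continuationUtility, condExp_castSucc]
  refine Finset.expect_congr rfl fun i hi => Finset.sum_congr rfl fun b _ => ?_
  rw [condExp_succ_payoffAfter_castSucc _ _ _ hi]

theorem utilityAt_eq_historyProb_mul_condExp (d : ReceiverStrategy n true) (t : Fin n)
    (θ₀ : Equiv.Perm (Fin n)) (σ₀ : Fin n → Bool) :
    utilityAt u φ d t θ₀ σ₀ = φ.historyProb t.castSucc θ₀ σ₀ *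
      φ.condExp t.castSucc θ₀ σ₀
        (fun θ σ => if σ t = σ₀ t then payoffAfter u d t.castSucc θ σ else 0) := by
  classical
  rw [← sum_cylinder_law_mul, utilityAt, ← Fintype.sum_prod_type']
  simp only [mul_ite, mul_zero]
  rw [← Finset.sum_filter, ← Finset.sum_filter]
  refine Finset.sum_congr ?_ fun _ _ => rfl
  ext p
  rw [Finset.mem_filter_univ, Finset.mem_filter, sameInfo_true_iff]

theorem utilityAt_eq (d : ReceiverStrategy n true) (t : Fin n) (θ₀ : Equiv.Perm (Fin n))
    (σ₀ : Fin n → Bool) :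
    utilityAt u φ d t θ₀ σ₀ = φ.historyProb t.castSucc θ₀ σ₀ *
      𝔼 i ∈ remainingFrom t.castSucc θ₀,
        φ.signalProb t (arrive θ₀ t i) σ₀ (σ₀ t) * φ.actUtility u d t θ₀ σ₀ i := by
  rw [utilityAt_eq_historyProb_mul_condExp, condExp_castSucc]
  congr 1
  refine Finset.expect_congr rfl fun i hi => ?_
  have hround {b p} (hp : p ∈ cylinder t.succ (arrive θ₀ t i) (Function.update σ₀ t b)) :
      p.2 t = b := by
    rw [(mem_cylinder.1 hp t t.castSucc_lt_succ).2, Function.update_self]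
  rw [Fintype.sum_eq_single (σ₀ t)]
  · rw [φ.condExp_congr fun p hp => if_pos (hround hp), Function.update_eq_self]
    exact congrArg _ (φ.condExp_succ_payoffAfter_castSucc u d hi)
  · intro b hb
    rw [φ.condExp_congr (g := fun _ _ => 0) fun p hp => if_neg ((hround hp).trans_ne hb),
      condExp_const, mul_zero]

theorem senderUtility_eq (θ : Equiv.Perm (Fin n)) (σ : Fin n → Bool) :
    senderUtility u φ = φ.continuationUtility u (obedient n disclosure) 0 θ σ := by
  rw [senderUtility, sum_law_mul, obedientPayoff_eq_payoffAfter, continuationUtility]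

end DirectMechanism

/-! ### The Shrinking Pareto mechanism -/

namespace ParetoProcedure

variable {ρ ξ : Fin n → ℝ} (P : ParetoProcedure ρ ξ) {t : Fin n} {θ : Equiv.Perm (Fin n)}
  {σ : Fin n → Bool} {i : Fin n}

theorem hireProb_shrinkingPareto_of_hired (hσ : ∃ s < t, σ s = true) :
    P.shrinkingPareto.hireProb t θ σ = 0 :=
  if_pos hσ

theorem hireProb_shrinkingPareto_arrive (hσ : ∀ s < t, σ s = false)
    (hi : i ∈ remainingFrom t.castSucc θ) :
    P.shrinkingPareto.hireProb t (arrive θ t i) σ =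
      P.returnProb (remainingFrom t.castSucc θ) i := by
  rw [← remainingFrom_castSucc_arrive hi]
  nth_rw 3 [← arrive_self θ t i]
  exact if_neg fun ⟨s, hs, h⟩ => Bool.false_ne_true ((hσ s hs).symm.trans h)

theorem continuationUtility_le_of_hired (hρ : ∀ i, 0 ≤ ρ i) (d : ReceiverStrategy n true)
    (t : Fin (n + 1)) (θ : Equiv.Perm (Fin n)) (σ : Fin n → Bool)
    (hσ : ∃ s : Fin n, s.castSucc < t ∧ σ s = true) :
    P.shrinkingPareto.continuationUtility ρ d t θ σ ≤ receiverMean ρ (remainingFrom t θ) := by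
  induction t using Fin.reverseInduction generalizing θ σ with
  | last => simp [DirectMechanism.continuationUtility_last, remainingFrom_last, receiverMean]
  | cast t ih =>
    obtain ⟨s, hst, hs⟩ := hσ
    have hsilent (θ') : P.shrinkingPareto.hireProb t θ' σ = 0 :=
      P.hireProb_shrinkingPareto_of_hired ⟨s, hst, hs⟩
    simp only [DirectMechanism.continuationUtility_castSucc, Fintype.sum_bool,
      DirectMechanism.signalProb_true, DirectMechanism.signalProb_false, hsilent, zero_mul,
      zero_add, sub_zero, one_mul]
    cases hd : d.hires t θ (Function.update σ t false) with
    | true =>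
      simp only [DirectMechanism.actUtility_of_hires _ _ _ hd, receiverMean_eq_expect, le_refl]
    | false =>
      refine le_trans (Finset.expect_le_expect fun i hi => ?_) (expect_receiverMean_erase_le hρ _)
      rw [DirectMechanism.actUtility_of_rejects _ _ _ hd, ← remainingFrom_succ_arrive hi]
      refine ih _ _ ⟨s, hst.trans t.castSucc_lt_succ, ?_⟩
      rwa [Function.update_of_ne (Fin.castSucc_lt_castSucc_iff.1 hst).ne]

theorem expect_returnProb_mul_actUtility_le (hρ : ∀ i, 0 ≤ ρ i) (d : ReceiverStrategy n true)
    (hσ : σ t = true) :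
    𝔼 i ∈ remainingFrom t.castSucc θ, P.returnProb (remainingFrom t.castSucc θ) i *
        P.shrinkingPareto.actUtility ρ d t θ σ i ≤
      𝔼 i ∈ remainingFrom t.castSucc θ, P.returnProb (remainingFrom t.castSucc θ) i * ρ i := by
  cases hd : d.hires t θ σ with
  | true => simp only [DirectMechanism.actUtility_of_hires _ _ _ hd, le_refl]
  | false =>
    refine le_trans (Finset.expect_le_expect fun i hi => ?_)
      (P.expect_returnProb_mul_receiverMean_erase_le hρ _)
    rw [DirectMechanism.actUtility_of_rejects _ _ _ hd, ← remainingFrom_succ_arrive hi]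
    exact mul_le_mul_of_nonneg_left
      (P.continuationUtility_le_of_hired hρ d _ _ _ ⟨t, t.castSucc_lt_succ, hσ⟩)
      (P.returnProb_nonneg hi)

theorem expect_one_sub_returnProb_mul_actUtility_le (d : ReceiverStrategy n true)
    (hcont : ∀ i ∈ remainingFrom t.castSucc θ,
      P.shrinkingPareto.continuationUtility ρ d t.succ (arrive θ t i) σ ≤
        P.value ρ ((remainingFrom t.castSucc θ).erase i)) :
    𝔼 i ∈ remainingFrom t.castSucc θ, (1 - P.returnProb (remainingFrom t.castSucc θ) i) *
        P.shrinkingPareto.actUtility ρ d t θ σ i ≤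
      𝔼 i ∈ remainingFrom t.castSucc θ, (1 - P.returnProb (remainingFrom t.castSucc θ) i) *
        P.value ρ ((remainingFrom t.castSucc θ).erase i) := by
  cases hd : d.hires t θ σ with
  | true =>
    simp only [DirectMechanism.actUtility_of_hires _ _ _ hd]
    refine (P.expect_le_expect_mul_receiverMean_erase _).trans
      (Finset.expect_le_expect fun i hi => ?_)
    exact mul_le_mul_of_nonneg_left (P.receiverMean_le_value _)
      (sub_nonneg.2 (P.returnProb_le_one hi))
  | false =>
    refine Finset.expect_le_expect fun i hi => ?_
    rw [DirectMechanism.actUtility_of_rejects _ _ _ hd]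
    exact mul_le_mul_of_nonneg_left (hcont i hi) (sub_nonneg.2 (P.returnProb_le_one hi))

theorem signalProb_shrinkingPareto_arrive (hσ : ∀ s < t, σ s = false)
    (hi : i ∈ remainingFrom t.castSucc θ) (b : Bool) :
    P.shrinkingPareto.signalProb t (arrive θ t i) σ b =
      if b then P.returnProb (remainingFrom t.castSucc θ) i
      else 1 - P.returnProb (remainingFrom t.castSucc θ) i := by
  rw [DirectMechanism.signalProb, P.hireProb_shrinkingPareto_arrive hσ hi]

theorem continuationUtility_castSucc (u : Fin n → ℝ) (d : ReceiverStrategy n true)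
    (hσ : ∀ s < t, σ s = false) :
    P.shrinkingPareto.continuationUtility u d t.castSucc θ σ =
      𝔼 i ∈ remainingFrom t.castSucc θ, P.returnProb (remainingFrom t.castSucc θ) i *
          P.shrinkingPareto.actUtility u d t θ (Function.update σ t true) i +
        𝔼 i ∈ remainingFrom t.castSucc θ, (1 - P.returnProb (remainingFrom t.castSucc θ) i) *
          P.shrinkingPareto.actUtility u d t θ (Function.update σ t false) i := by
  rw [DirectMechanism.continuationUtility_castSucc, ← Finset.expect_add_distrib]
  refine Finset.expect_congr rfl fun i hi => ?_
  simp [P.signalProb_shrinkingPareto_arrive hσ hi]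

theorem utilityAt_shrinkingPareto (u : Fin n → ℝ) (d : ReceiverStrategy n true)
    (hσ : ∀ s < t, σ s = false) :
    utilityAt u P.shrinkingPareto d t θ σ = P.shrinkingPareto.historyProb t.castSucc θ σ *
      𝔼 i ∈ remainingFrom t.castSucc θ,
        (if σ t then P.returnProb (remainingFrom t.castSucc θ) i
          else 1 - P.returnProb (remainingFrom t.castSucc θ) i) *
        P.shrinkingPareto.actUtility u d t θ σ i := by
  rw [DirectMechanism.utilityAt_eq]
  congr 1
  exact Finset.expect_congr rfl fun i hi => by rw [P.signalProb_shrinkingPareto_arrive hσ hi]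

theorem update_eq_false_of_lt_succ (hσ : ∀ s < t, σ s = false) (s : Fin n)
    (hs : s.castSucc < t.succ) : Function.update σ t false s = false := by
  rcases (Fin.castSucc_lt_succ_iff.1 hs).eq_or_lt with rfl | hs
  · exact Function.update_self s false σ
  · rw [Function.update_of_ne hs.ne, hσ s hs]

theorem continuationUtility_le_value (hρ : ∀ i, 0 ≤ ρ i) (d : ReceiverStrategy n true)
    (t : Fin (n + 1)) (θ : Equiv.Perm (Fin n)) (σ : Fin n → Bool)
    (hσ : ∀ s : Fin n, s.castSucc < t → σ s = false) :
    P.shrinkingPareto.continuationUtility ρ d t θ σ ≤ P.value ρ (remainingFrom t θ) := by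
  induction t using Fin.reverseInduction generalizing θ σ with
  | last => rw [DirectMechanism.continuationUtility_last, remainingFrom_last, value_empty]
  | cast t ih =>
    rw [P.continuationUtility_castSucc ρ d hσ, value_eq, Finset.expect_add_distrib]
    refine add_le_add
      (P.expect_returnProb_mul_actUtility_le hρ d (Function.update_self t true σ))
      (P.expect_one_sub_returnProb_mul_actUtility_le d fun i hi => ?_)
    rw [← remainingFrom_succ_arrive hi]
    exact ih _ _ (update_eq_false_of_lt_succ hσ)

theorem continuationUtility_obedient (u : Fin n → ℝ) (t : Fin (n + 1)) (θ : Equiv.Perm (Fin n))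
    (σ : Fin n → Bool) (hσ : ∀ s : Fin n, s.castSucc < t → σ s = false) :
    P.shrinkingPareto.continuationUtility u (obedient n true) t θ σ =
      P.value u (remainingFrom t θ) := by
  induction t using Fin.reverseInduction generalizing θ σ with
  | last => rw [DirectMechanism.continuationUtility_last, remainingFrom_last, value_empty]
  | cast t ih =>
    rw [P.continuationUtility_castSucc u _ hσ, value_eq, Finset.expect_add_distrib]
    congr 1 <;> refine Finset.expect_congr rfl fun i hi => ?_
    · rw [DirectMechanism.actUtility_of_hires _ _ _ (Function.update_self t true σ)]
    · rw [DirectMechanism.actUtility_of_rejects _ _ _ (Function.update_self t false σ),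
        ih _ _ (update_eq_false_of_lt_succ hσ), remainingFrom_succ_arrive hi]

theorem persuasive_shrinkingPareto (hρ : ∀ i, 0 ≤ ρ i) : Persuasive true ρ P.shrinkingPareto := by
  intro t θ σ hσ d
  rw [P.utilityAt_shrinkingPareto ρ d hσ, P.utilityAt_shrinkingPareto ρ (obedient n true) hσ]
  refine mul_le_mul_of_nonneg_left ?_ (DirectMechanism.historyProb_nonneg _)
  cases ht : σ t with
  | true =>
    simpa [DirectMechanism.actUtility_of_hires _ _ (obedient n true) ht] using
      P.expect_returnProb_mul_actUtility_le hρ d ht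
  | false =>
    have hσ' : ∀ s : Fin n, s.castSucc < t.succ → σ s = false :=
      forall_castSucc_lt_succ_iff.2 ⟨hσ, ht⟩
    have hobedient (i) (hi : i ∈ remainingFrom t.castSucc θ) :
        P.shrinkingPareto.actUtility ρ (obedient n true) t θ σ i =
          P.value ρ ((remainingFrom t.castSucc θ).erase i) := by
      rw [DirectMechanism.actUtility_of_rejects _ _ _ ht,
        P.continuationUtility_obedient ρ _ _ _ hσ', remainingFrom_succ_arrive hi]
    simp only [Bool.false_eq_true, if_false]
    refine (P.expect_one_sub_returnProb_mul_actUtility_le d fun i hi => ?_).trans_eq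
      (Finset.expect_congr rfl fun i hi => by rw [hobedient i hi])
    rw [← remainingFrom_succ_arrive hi]
    exact P.continuationUtility_le_value hρ d _ _ _ hσ'

theorem senderUtility_shrinkingPareto (u : Fin n → ℝ) :
    senderUtility u P.shrinkingPareto = P.value u Finset.univ := by
  rw [DirectMechanism.senderUtility_eq _ u 1 fun _ => false,
    P.continuationUtility_obedient u 0 1 _ fun _ _ => rfl, remainingFrom_zero]

end ParetoProcedure

/-! ### The benchmark -/

section Benchmark

variable {ρ ξ : Fin n → ℝ} {φ : DirectMechanism n}

/-- The strategy of hiring the first candidate, which is what the receiver can do without any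
information. -/
def hireAlways (n : ℕ) (disclosure : Bool) : ReceiverStrategy n disclosure where
  hires _ _ _ := true
  adapted _ _ _ _ _ _ := rfl

variable [NeZero n]

theorem sum_utilityAt_zero (u : Fin n → ℝ) (d : ReceiverStrategy n false)
    (θ : Equiv.Perm (Fin n)) (σ : Fin n → Bool) :
    ∑ b, utilityAt u φ d 0 θ (fun _ => b) = φ.continuationUtility u d 0 θ σ := by
  classical
  have hinfo (θ' : Equiv.Perm (Fin n)) (σ' : Fin n → Bool) (b : Bool) :
      SameInfo false 0 θ θ' (fun _ => b) σ' ↔ b = σ' 0 := by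
    simp [SameInfo]
  rw [DirectMechanism.continuationUtility, ← DirectMechanism.sum_law_mul]
  simp only [utilityAt, hinfo]
  rw [Finset.sum_comm]
  refine Finset.sum_congr rfl fun θ' _ => ?_
  rw [Finset.sum_comm]
  refine Finset.sum_congr rfl fun σ' _ => ?_
  rw [Finset.sum_ite_eq', if_pos (Finset.mem_univ _), payoffFrom_eq_payoffAfter,
    Fin.castSucc_zero']

theorem continuationUtility_hireAlways (u : Fin n → ℝ) (disclosure : Bool)
    (θ : Equiv.Perm (Fin n)) (σ : Fin n → Bool) :
    φ.continuationUtility u (hireAlways n disclosure) 0 θ σ = receiverMean u Finset.univ := by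
  have hact (σ' : Fin n → Bool) (i : Fin n) :
      φ.actUtility u (hireAlways n disclosure) 0 θ σ' i = u i :=
    φ.actUtility_of_hires u _ rfl
  rw [← Fin.castSucc_zero', DirectMechanism.continuationUtility_castSucc, Fin.castSucc_zero',
    remainingFrom_zero, receiverMean_eq_expect]
  simp only [hact, ← Finset.sum_mul, DirectMechanism.sum_signalProb, one_mul]

theorem receiverMean_le_senderUtility (hφ : Persuasive false ρ φ) :
    receiverMean ρ Finset.univ ≤ senderUtility ρ φ := by
  rw [← continuationUtility_hireAlways ρ false 1 fun _ => false, ← sum_utilityAt_zero,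
    DirectMechanism.senderUtility_eq φ ρ (disclosure := false) 1 fun _ => false,
    ← sum_utilityAt_zero]
  exact Finset.sum_le_sum fun b _ => hφ 0 1 _ (fun s hs => absurd hs (Fin.not_lt_zero s)) _

theorem exists_obedientPayoff_le (θ : Equiv.Perm (Fin n)) (σ : Fin n → Bool) :
    ∃ i, ∀ u : Fin n → ℝ, (∀ j, 0 ≤ u j) → obedientPayoff u θ σ ≤ u i := by
  by_cases h : ∃ t, σ t = true ∧ ∀ s < t, σ s = false
  · obtain ⟨t, ht, hfirst⟩ := h
    refine ⟨θ t, fun u _ => ?_⟩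
    rw [obedientPayoff, Fintype.sum_eq_single t, if_pos ⟨ht, hfirst⟩]
    refine fun s hst => if_neg fun ⟨hs, hs'⟩ => ?_
    rcases lt_or_gt_of_ne hst with hlt | hlt
    · exact Bool.false_ne_true ((hfirst s hlt).symm.trans hs)
    · exact Bool.false_ne_true ((hs' t hlt).symm.trans ht)
  · refine ⟨0, fun u hu => le_of_eq_of_le ?_ (hu 0)⟩
    exact Finset.sum_eq_zero fun t _ => if_neg fun ht => h ⟨t, ht⟩

theorem exists_mem_valuationHull_senderUtility_le (hρ : ∀ i, 0 ≤ ρ i) (hξ : ∀ i, 0 ≤ ξ i)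
    (φ : DirectMechanism n) :
    ∃ q ∈ valuationHull ρ ξ Finset.univ, senderUtility ρ φ ≤ q.1 ∧ senderUtility ξ φ ≤ q.2 := by
  choose hired hhired using exists_obedientPayoff_le (n := n)
  refine ⟨∑ p : Equiv.Perm (Fin n) × (Fin n → Bool),
    φ.law p.1 p.2 • (ρ (hired p.1 p.2), ξ (hired p.1 p.2)), ?_, ?_, ?_⟩
  · refine convex_valuationHull.sum_mem (fun p _ => φ.law_nonneg p.1 p.2) ?_
      fun p _ => mem_valuationHull (Finset.mem_univ _)
    rw [Fintype.sum_prod_type, φ.sum_law]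
  · rw [Prod.fst_sum, Fintype.sum_prod_type]
    exact Finset.sum_le_sum fun θ _ => Finset.sum_le_sum fun σ _ =>
      mul_le_mul_of_nonneg_left (hhired θ σ ρ hρ) (φ.law_nonneg θ σ)
  · rw [Prod.snd_sum, Fintype.sum_prod_type]
    exact Finset.sum_le_sum fun θ _ => Finset.sum_le_sum fun σ _ =>
      mul_le_mul_of_nonneg_left (hhired θ σ ξ hξ) (φ.law_nonneg θ σ)

theorem ParetoProcedure.benchmarkOpt_le_returned (P : ParetoProcedure ρ ξ) (hρ : ∀ i, 0 ≤ ρ i)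
    (hξ : ∀ i, 0 ≤ ξ i) : benchmarkOpt ρ ξ ≤ P.returned ξ Finset.univ := by
  refine (isLUB_benchmarkOpt ρ ξ hρ).2 ?_
  rintro _ ⟨φ, hφ, rfl⟩
  obtain ⟨q, hq, hqρ, hqξ⟩ := exists_mem_valuationHull_senderUtility_le hρ hξ φ
  exact hqξ.trans (P.snd_le_returned Finset.univ_nonempty hq
    ((receiverMean_le_senderUtility hφ).trans hqρ))

end Benchmark

end OnlinePersuasion

theorem mainTheorem7_general {n : ℕ} {ρ ξ : Fin n → ℝ} (hρ : ∀ i, 0 ≤ ρ i) (hξ : ∀ i, 0 ≤ ξ i)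
    (P : OnlinePersuasion.ParetoProcedure ρ ξ) :
    OnlinePersuasion.Persuasive true ρ P.shrinkingPareto ∧
      1 / 3 * OnlinePersuasion.benchmarkOpt ρ ξ ≤
        OnlinePersuasion.senderUtility ξ P.shrinkingPareto := by
  have : NeZero n := (P.a ∅).neZero
  refine ⟨P.persuasive_shrinkingPareto hρ, ?_⟩
  calc 1 / 3 * OnlinePersuasion.benchmarkOpt ρ ξ
      ≤ 1 / 3 * P.returned ξ Finset.univ := by
        gcongr
        exact P.benchmarkOpt_le_returned hρ hξ
    _ ≤ P.value ξ Finset.univ := by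
        linarith [P.returned_le_three_mul_value hξ Finset.univ]
    _ = OnlinePersuasion.senderUtility ξ P.shrinkingPareto :=
        (P.senderUtility_shrinkingPareto ξ).symm

theorem mainTheorem7 :
    ∃ δ : ℕ → ℝ, Filter.Tendsto δ Filter.atTop (nhds 0) ∧
      ∀ n : ℕ, 0 < n → ∀ ρ ξ : Fin n → ℝ, (∀ i, 0 ≤ ρ i) → (∀ i, 0 ≤ ξ i) →
        ∀ P : OnlinePersuasion.ParetoProcedure ρ ξ,
          OnlinePersuasion.Persuasive true ρ P.shrinkingPareto ∧
          (1 / 3 - δ n) * OnlinePersuasion.benchmarkOpt ρ ξ ≤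
            OnlinePersuasion.senderUtility ξ P.shrinkingPareto := by
  exact ⟨fun _ => 0, tendsto_const_nhds, fun _ _ ρ ξ hρ hξ P => by
    simpa only [sub_zero] using mainTheorem7_general hρ hξ P⟩
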